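/- **Setup.** Let $\beta:[0,1]\to\mathbb R$ be three times continuously differentiable (hence with bounded derivatives), let $x\in(0,1)$, $\sigma>0$, and let $y_t=\beta(x_t)+\varepsilon_t$, $x_t=t/n$, $t=1,\dots,n$, where $(\varepsilon_t)_{t\ge1}$ are i.i.d. with $E\varepsilon_t=0$, $E\varepsilon_t^2=\sigma^2$ and $E|\varepsilon_t|^{2+\delta}<\infty$ for some $\delta>0$. Let $K:\mathbb R\to[0,\infty)$ be a kernel, i.e. symmetric, of bounded variation, with $K(u)=0$ for $u\notin(-1,1)$, $\int K=1$, $\int u^2K(u)\,du\neq0$ and $R_K:=\int K^2\in(0,\infty)$. Let $h=cn^{-1/5}$ with $c>0$, $\hat\beta_h(z)=(nh)^{-1}\sum_{t=1}^nK((x_t-z)/h)y_t$, $k_t=K((x_t-x)/h)$, $D_n=(y_1,\dots,y_n)$, and $$T_n=(nh)^{1/2}(\hat\beta_h(x)-\beta(x)),\qquad B_n=(nh)^{1/2}\Big(\tfrac1{nh}\sum_{t=1}^nk_t\beta(x_t)-\beta(x)\Big).$$ Let $\hat\sigma_n^2\ge0$ be a measurable function of $D_n$ with $\hat\sigma_n^2\to_p\sigma^2$.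 Let the bootstrap sample be $y_t^*=\hat\beta_h(x_t)+\varepsilon_t^*$, where, conditionally on $D_n$, $\varepsilon_1^*,\dots,\varepsilon_n^*$ are i.i.d. $N(0,\hat\sigma_n^2)$; put $\hat\beta_h^*(x)=(nh)^{-1}\sum_tk_ty_t^*$ and $$T_n^*=(nh)^{1/2}(\hat\beta_h^*(x)-\hat\beta_h(x)),\qquad \hat B_n=(nh)^{1/2}\Big(\tfrac1{nh}\sum_{t=1}^nk_t\hat\beta_h(x_t)-\hat\beta_h(x)\Big).$$ Let $$V=\begin{pmatrix}v^2&\omega_{12}-v^2\\ \omega_{12}-v^2&v^2+\omega_{22}-2\omega_{12}\end{pmatrix},$$ where $v^2=\sigma^2R_K$, $\omega_{12}=\sigma^2\int K(u)\int K(s-u)K(s)\,ds\,du$ and $\omega_{22}=\sigma^2\int\big(\int K(s-u)K(s)\,ds\big)^2du$, and let $(\xi_1,\xi_2)'\sim N(0,V)$. **Claim.** 1. $T_n-B_n\to_d\xi_1$; $\xi_1$ has mean zero, and its cdf $G(u)=P(\xi_1\le u)$ is continuous, and strictly increasing on the support of $\xi_1$. 2. $\hat B_n$ is $D_n$-measurable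 and: (i) $P(T_n^*-\hat B_n\le u\mid D_n)\to_pG(u)$ for every continuity point $u$ of $G$; (ii) $(T_n-B_n,\hat B_n-B_n)'\to_d(\xi_1,\xi_2)'$, where $\xi_2$ has mean zero and $F(u)=P(\xi_1-\xi_2\le u)$ is a continuous cdf. 3. $V$ is positive definite, and it is continuous in $\sigma^2$ and the kernel: if $s_m\to\sigma^2$ in $\mathbb R$ and $K_m$ are kernels (in the above sense) with $\int(K_m-K)^2\to0$, then the matrices $V$ formed with $(s_m,K_m)$ in place of $(\sigma^2,K)$ converge to $V$. -/

import Mathlib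

open MeasureTheory ProbabilityTheory Filter Topology
open scoped NNReal ENNReal

namespace NPBoot

noncomputable section

/-! ### General bootstrap framework -/

/-- Convergence in distribution in the bootstrap world, in probability: at every continuity
point `u` of the cdf of `ξ`, the conditional probability `P*(Y n ≤ u)` given the `σ`-algebra `m n`
generated by the original data converges in probability to `P'(ξ ≤ u)`. -/
def TendstoBootstrapDistribution {Ω Ω' : Type*} [mΩ : MeasurableSpace Ω] [MeasurableSpace Ω']
    (P : Measure Ω) (m : ℕ → MeasurableSpace Ω) (Y : ℕ → Ω → ℝ)
    (P' : Measure Ω') (ξ : Ω' → ℝ) : Prop :=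
  (∀ n, m n ≤ mΩ) ∧ (∀ n, AEMeasurable (Y n) P) ∧
  ∀ u : ℝ, ContinuousAt (fun v : ℝ => P'.real {ω' | ξ ω' ≤ v}) u →
    TendstoInMeasure P (fun n => P⟦{ω | Y n ω ≤ u} | m n⟧) atTop
      (fun _ => P'.real {ω' | ξ ω' ≤ u})

/-- `T n - B n` converges in distribution to `ξ₁`, which is centered at zero and has a cdf that is
continuous, and strictly increasing over the support of (the law of) `ξ₁`. -/
structure BiasedLimit {Ω Ω' : Type*} [MeasurableSpace Ω] [MeasurableSpace Ω']
    (P : Measure Ω) [IsProbabilityMeasure P] (T B : ℕ → Ω → ℝ)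
    (P' : Measure Ω') [IsProbabilityMeasure P'] (ξ₁ : Ω' → ℝ) : Prop where
  tendsto : TendstoInDistribution (fun n ω => T n ω - B n ω) atTop ξ₁ (fun _ => P) P'
  integrable : Integrable ξ₁ P'
  centered : ∫ ω', ξ₁ ω' ∂P' = 0
  continuous_cdf : Continuous (fun u : ℝ => P'.real {ω' | ξ₁ ω' ≤ u})
  strictMonoOn_cdf :
    StrictMonoOn (fun u : ℝ => P'.real {ω' | ξ₁ ω' ≤ u}) (P'.map ξ₁).support

/-- The bootstrap statistic `Tstar n` has the data-measurable implicit bias `Bhat n`: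
conditionally on the data, `Tstar n - Bhat n` has the limit law of `ξ₁`, and
`(T n - B n, Bhat n - B n)` converges jointly in distribution to `(ξ₁, ξ₂)`, where `ξ₂` is centered
at zero and `ξ₁ - ξ₂` has a continuous cdf. -/
structure BootstrapBiasedLimit {Ω Ω' : Type*} [MeasurableSpace Ω] [MeasurableSpace Ω']
    (P : Measure Ω) [IsProbabilityMeasure P] (m : ℕ → MeasurableSpace Ω)
    (T B Tstar Bhat : ℕ → Ω → ℝ)
    (P' : Measure Ω') [IsProbabilityMeasure P'] (ξ₁ ξ₂ : Ω' → ℝ) : Prop where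
  measurable_bias : ∀ n, Measurable[m n] (Bhat n)
  bootstrap_tendsto :
    TendstoBootstrapDistribution P m (fun n ω => Tstar n ω - Bhat n ω) P' ξ₁
  joint_tendsto :
    TendstoInDistribution (fun n ω => (T n ω - B n ω, Bhat n ω - B n ω)) atTop
      (fun ω' => (ξ₁ ω', ξ₂ ω')) (fun _ => P) P'
  integrable : Integrable ξ₂ P'
  centered : ∫ ω', ξ₂ ω' ∂P' = 0
  continuous_cdf : Continuous (fun u : ℝ => P'.real {ω' | ξ₁ ω' - ξ₂ ω' ≤ u})

/-! ### Kernels and the limiting variance -/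

/-- The kernels considered: nonnegative, symmetric, vanishing off `(-1, 1)`, of bounded variation,
with `∫ K = 1`, nonzero second moment and `∫ K² ∈ (0, ∞)`. -/
structure IsKernel (K : ℝ → ℝ) : Prop where
  nonneg : ∀ u, 0 ≤ K u
  symm : ∀ u, K (-u) = K u
  eq_zero : ∀ u, u ∉ Set.Ioo (-1 : ℝ) 1 → K u = 0
  boundedVariation : BoundedVariationOn K Set.univ
  integral_eq_one : ∫ u, K u = 1
  secondMoment_ne_zero : ∫ u, u ^ 2 * K u ≠ 0
  integrable_sq : Integrable (fun u => K u ^ 2)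
  integral_sq_pos : 0 < ∫ u, K u ^ 2

/-- `u ↦ ∫ K(s - u) K(s) ds`. -/
def selfConv (K : ℝ → ℝ) (u : ℝ) : ℝ := ∫ s, K (s - u) * K s

/-- `v² = σ² ∫ K(u)² du`; the argument `s` is the error variance `σ²`. -/
def vSq (s : ℝ) (K : ℝ → ℝ) : ℝ := s * ∫ u, K u ^ 2

/-- `ω₁₂ = σ² ∫ K(u) ∫ K(s - u) K(s) ds du`. -/
def omega12 (s : ℝ) (K : ℝ → ℝ) : ℝ := s * ∫ u, K u * selfConv K u

/-- `ω₂₂ = σ² ∫ (∫ K(s - u) K(s) ds)² du`. -/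
def omega22 (s : ℝ) (K : ℝ → ℝ) : ℝ := s * ∫ u, selfConv K u ^ 2

/-- The limiting variance matrix `V`, as a function of the error variance and the kernel. -/
def limitVar (s : ℝ) (K : ℝ → ℝ) : Matrix (Fin 2) (Fin 2) ℝ :=
  !![vSq s K, omega12 s K - vSq s K;
     omega12 s K - vSq s K, vSq s K + omega22 s K - 2 * omega12 s K]

/-! ### Fixed-design Nadaraya-Watson regression -/

/-- The bandwidth `h = c n^{-1/5}`. -/
def bandwidth (c : ℝ) (n : ℕ) : ℝ := c * (n : ℝ) ^ (-(1 / 5) : ℝ)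

/-- The design points `1/n, 2/n, …, n/n`; the index `t : Fin n` is the observation `t + 1`. -/
def design (n : ℕ) (t : Fin n) : ℝ := ((t : ℕ) + 1 : ℝ) / n

/-- The estimator `(nh)⁻¹ ∑ₜ K((xₜ - z)/h) yₜ` at the point `z`, from the observations `y`. -/
def nw (K : ℝ → ℝ) (c : ℝ) (n : ℕ) (y : Fin n → ℝ) (z : ℝ) : ℝ :=
  (n * bandwidth c n)⁻¹ * ∑ t, K ((design n t - z) / bandwidth c n) * y t

/-- The sample `yₜ = β(xₜ) + εₜ`, where `ε t` is the error of observation `t + 1`. -/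
def sample {Ω : Type*} (β : ℝ → ℝ) (ε : ℕ → Ω → ℝ) (n : ℕ) (ω : Ω) : Fin n → ℝ :=
  fun t => β (design n t) + ε t ω

/-- `Tₙ = (nh)^{1/2} (β̂(x) - β(x))` as a function of the sample `y`. -/
def stat (K : ℝ → ℝ) (c : ℝ) (β : ℝ → ℝ) (x : ℝ) (n : ℕ) (y : Fin n → ℝ) : ℝ :=
  Real.sqrt (n * bandwidth c n) * (nw K c n y x - β x)

/-- `Bₙ = (nh)^{1/2} ((nh)⁻¹ ∑ₜ kₜ β(xₜ) - β(x))`. -/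
def bias (K : ℝ → ℝ) (c : ℝ) (β : ℝ → ℝ) (x : ℝ) (n : ℕ) : ℝ :=
  Real.sqrt (n * bandwidth c n) * (nw K c n (fun t => β (design n t)) x - β x)

/-- The bootstrap sample `yₜ* = β̂(xₜ) + εₜ*`. -/
def bootSample (K : ℝ → ℝ) (c : ℝ) (n : ℕ) (y e : Fin n → ℝ) : Fin n → ℝ :=
  fun t => nw K c n y (design n t) + e t

/-- `Tₙ* = (nh)^{1/2} (β̂*(x) - β̂(x))` as a function of the sample `y` and of the bootstrap
errors `e`. -/
def bootStat (K : ℝ → ℝ) (c x : ℝ) (n : ℕ) (y e : Fin n → ℝ) : ℝ :=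
  Real.sqrt (n * bandwidth c n) * (nw K c n (bootSample K c n y e) x - nw K c n y x)

/-- `B̂ₙ = (nh)^{1/2} ((nh)⁻¹ ∑ₜ kₜ β̂(xₜ) - β̂(x))` as a function of the sample `y`. -/
def bootBias (K : ℝ → ℝ) (c x : ℝ) (n : ℕ) (y : Fin n → ℝ) : ℝ :=
  Real.sqrt (n * bandwidth c n) *
    (nw K c n (fun t => nw K c n y (design n t)) x - nw K c n y x)

/-- The errors are i.i.d. with mean `0`, variance `σ²` and a finite absolute moment of some order
`2 + δ`, `δ > 0`. -/
structure IsErrorSequence {Ω : Type*} [MeasurableSpace Ω] (P : Measure Ω)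
    (ε : ℕ → Ω → ℝ) (σ : ℝ) : Prop where
  measurable : ∀ t, Measurable (ε t)
  indep : iIndepFun ε P
  identDistrib : ∀ t, IdentDistrib (ε t) (ε 0) P P
  mean : ∫ ω, ε 0 ω ∂P = 0
  variance : Var[ε 0; P] = σ ^ 2
  moment : ∃ δ : ℝ, 0 < δ ∧ Integrable (fun ω => |ε 0 ω| ^ (2 + δ)) P

/-- `εstar n` are bootstrap errors for the data `D n`: conditionally on `D n` they are i.i.d.
`N(0, varEst n (D n))`. -/
structure IsGaussianBootstrapErrors {Ω : Type*} [MeasurableSpace Ω] (P : Measure Ω)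
    [IsProbabilityMeasure P] (D : ∀ n : ℕ, Ω → Fin n → ℝ)
    (varEst : ∀ n : ℕ, (Fin n → ℝ) → ℝ≥0) (εstar : ∀ n : ℕ, Ω → Fin n → ℝ) : Prop where
  measurable : ∀ n, Measurable (εstar n)
  condLaw : ∀ n, ∀ᵐ y ∂(P.map (D n)),
    condDistrib (εstar n) (D n) P y = Measure.pi (fun _ : Fin n => gaussianReal 0 (varEst n y))

end

end NPBoot

/-!
Write `kₛ = K((xₛ - x) / h)` and let `wₛ = (nh)⁻¹ ∑ₜ kₜ K((xₛ - xₜ) / h)` be the weight of the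
`s`-th error in the smoother applied twice. Since the smoother is linear in the data,
`Tₙ - Bₙ = (nh)^{-1/2} ∑ kₛ εₛ`, while `B̂ₙ - Bₙ` is `(nh)^{-1/2} ∑ (wₛ - kₛ) εₛ` plus a
deterministic term.

*Riemann sums.* For a function of bounded variation supported in the window, the normalized sum over
the design differs from the integral by at most the total variation divided by `nh`
(`abs_designSum_sub_integral_le`). This is the only approximation device needed for the kernel, which
may be discontinuous: it shows that `wₛ` is uniformly within `O(1/(nh))` of `K ∗ K` at the rescaled
design point, so that `(nh)⁻¹ ∑ (p kₛ + q (wₛ - kₛ))²` tends to `∫ (p K + q (K ∗ K - K))²`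
(`IsKernel.errorWeight_asymptotics`). Times `σ²`, this is the quadratic form of `V`. It is positive
definite because the integral and the second moment of `p K + q (K ∗ K - K)` are `p` and `(p + q)`
times those of `K` (`IsKernel.integral_limitWeight_sq_pos`).

*Bias.* The bias of the smoother at a point `z` near `x` is `h² b(z)` with `b` Lipschitz, up to
`O(1/(nh) + h³)`. Over a window of width `h` it is therefore constant up to that order, smoothing it
once more changes it by `O(1/(nh) + h³)`, and `(nh)^{1/2}` times this vanishes for `h = c n^{-1/5}`
(`IsKernel.tendsto_smoothed_bias_sub`).

*Limit theorem.* A linear form in the pair of statistics is a weighted sum of i.i.d. errors with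
uniformly vanishing weights. Its characteristic function is a product, which is compared factor by
factor with the normal one (`IsErrorSequence.tendsto_charFun_weightedSum`); a finite second moment is
enough here. Lévy's theorem in the plane then gives the joint limit.

*Bootstrap.* Given the data, `Tₙ* - B̂ₙ = (nh)^{-1/2} ∑ kₜ εₜ*` is exactly normal with variance
`σ̂ₙ² (nh)⁻¹ ∑ kₜ²`, which tends to `v²` in probability, and the normal distribution function is
continuous in the variance at `v² > 0` (`tendstoBootstrapDistribution_bootStat`).

*Continuity of `V`.* By the Cauchy-Schwarz inequality `K ↦ K ∗ K` is locally Lipschitz from `L²` to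
the uniform norm (`IsKernel.abs_selfConv_sub_le`).
-/

namespace NPBoot

/-! ### Functions of bounded variation and Riemann sums -/

lemma measurable_of_boundedVariationOn {f : ℝ → ℝ} (hf : BoundedVariationOn f Set.univ) :
    Measurable f := by
  obtain ⟨p, q, hp, hq, rfl⟩ :=
    hf.locallyBoundedVariationOn.exists_monotoneOn_sub_monotoneOn
  exact (monotoneOn_univ.1 hp).measurable.sub (monotoneOn_univ.1 hq).measurable

lemma exists_abs_le_of_boundedVariationOn {f : ℝ → ℝ} (hf : BoundedVariationOn f Set.univ) :
    ∃ M : ℝ, 0 ≤ M ∧ ∀ u, |f u| ≤ M := by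
  refine ⟨|f 0| + (eVariationOn f Set.univ).toReal, by positivity, fun u => ?_⟩
  have h := hf.dist_le (Set.mem_univ u) (Set.mem_univ 0)
  rw [Real.dist_eq] at h
  have h2 := abs_add_le (f 0) (f u - f 0)
  rw [add_sub_cancel] at h2
  linarith

lemma integrable_of_boundedVariationOn {f : ℝ → ℝ} (hf : BoundedVariationOn f Set.univ) {R : ℝ}
    (h0 : ∀ u, u ∉ Set.Ioo (-R) R → f u = 0) : Integrable f := by
  obtain ⟨M, -, hM⟩ := exists_abs_le_of_boundedVariationOn hf
  have h1 : IntegrableOn f (Set.Ioo (-R) R) :=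
    IntegrableOn.of_bound (by simp) (measurable_of_boundedVariationOn hf).aestronglyMeasurable M
      (Eventually.of_forall hM)
  exact (integrableOn_iff_integrable_of_support_subset fun u hu => by
    by_contra h
    exact hu (h0 u h)).1 h1

lemma boundedVariationOn_add {f g : ℝ → ℝ} (hf : BoundedVariationOn f Set.univ)
    (hg : BoundedVariationOn g Set.univ) : BoundedVariationOn (fun u => f u + g u) Set.univ := by
  refine ne_top_of_le_ne_top (ENNReal.add_ne_top.2 ⟨hf, hg⟩) (iSup_le ?_)
  rintro ⟨n, u, hu, -⟩
  calc _ ≤ ∑ i ∈ Finset.range n, (edist (f (u (i + 1))) (f (u i)) +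
        edist (g (u (i + 1))) (g (u i))) := Finset.sum_le_sum fun i _ => edist_add_add_le _ _ _ _
    _ ≤ _ := by
      rw [Finset.sum_add_distrib]
      exact add_le_add (eVariationOn.sum_le hu fun _ => Set.mem_univ _)
        (eVariationOn.sum_le hu fun _ => Set.mem_univ _)

lemma boundedVariationOn_const_mul {f : ℝ → ℝ} (hf : BoundedVariationOn f Set.univ) (a : ℝ) :
    BoundedVariationOn (fun u => a * f u) Set.univ :=
  (lipschitzWith_smul a).comp_boundedVariationOn hf

/-- A product rule for the total variation, with real-valued bounds. -/
lemma boundedVariationOn_mul_toReal_le {f g : ℝ → ℝ} (hf : BoundedVariationOn f Set.univ)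
    (hg : BoundedVariationOn g Set.univ) {C D : ℝ} (hC : ∀ u, |f u| ≤ C) (hD : ∀ u, |g u| ≤ D) :
    (eVariationOn (fun u => f u * g u) Set.univ).toReal ≤
      C * (eVariationOn g Set.univ).toReal + D * (eVariationOn f Set.univ).toReal := by
  have hC0 : 0 ≤ C := (abs_nonneg _).trans (hC 0)
  have hD0 : 0 ≤ D := (abs_nonneg _).trans (hD 0)
  have h : eVariationOn (fun u => f u * g u) Set.univ ≤
      ENNReal.ofReal C * eVariationOn g Set.univ + ENNReal.ofReal D * eVariationOn f Set.univ :=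
    eVariationOn_fun_mul_le
      (fun u _ => by rw [Real.enorm_eq_ofReal_abs]; exact ENNReal.ofReal_le_ofReal (hC u))
      (fun u _ => by rw [Real.enorm_eq_ofReal_abs]; exact ENNReal.ofReal_le_ofReal (hD u))
  have hf' : eVariationOn f Set.univ ≠ ∞ := hf
  have hg' : eVariationOn g Set.univ ≠ ∞ := hg
  have h' := ENNReal.toReal_mono (by finiteness) h
  rwa [ENNReal.toReal_add (by finiteness) (by finiteness), ENNReal.toReal_mul, ENNReal.toReal_mul,
    ENNReal.toReal_ofReal hC0, ENNReal.toReal_ofReal hD0] at h'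

/-- A right-endpoint Riemann sum over a mesh of width `d` differs from the integral by at most
`d` times the total variation. -/
lemma abs_sum_sub_intervalIntegral_le {f : ℝ → ℝ} (hf : BoundedVariationOn f Set.univ)
    {u : ℕ → ℝ} {d : ℝ} (hd : 0 ≤ d) (hu : ∀ i, u (i + 1) - u i = d) (n : ℕ) :
    |d * ∑ i ∈ Finset.range n, f (u (i + 1)) - ∫ v in (u 0)..(u n), f v| ≤
      d * (eVariationOn f Set.univ).toReal := by
  obtain ⟨M, hM0, hM⟩ := exists_abs_le_of_boundedVariationOn hf
  have hmono : Monotone u := monotone_nat_of_le_succ fun i => by linarith [hu i]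
  have hint : ∀ a b : ℝ, IntervalIntegrable f volume a b := fun a b =>
    (intervalIntegrable_const (c := M)).mono_fun
      (measurable_of_boundedVariationOn hf).aestronglyMeasurable
      (Eventually.of_forall fun v => by
        simpa [abs_of_nonneg hM0] using hM v)
  have hfin : ∀ s : Set ℝ, eVariationOn f s ≠ ∞ := fun s => hf.mono (Set.subset_univ s)
  have hcell : ∀ i, |d * f (u (i + 1)) - ∫ v in (u i)..(u (i + 1)), f v| ≤
      d * (eVariationOn f (Set.Icc (u i) (u (i + 1)))).toReal := by
    intro i
    have h1 : d * f (u (i + 1)) - ∫ v in (u i)..(u (i + 1)), f v =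
        ∫ v in (u i)..(u (i + 1)), (f (u (i + 1)) - f v) := by
      rw [intervalIntegral.integral_sub intervalIntegrable_const (hint _ _)]
      simp [hu i]
    have h2 := intervalIntegral.norm_integral_le_of_norm_le_const (a := u i) (b := u (i + 1))
      (C := (eVariationOn f (Set.Icc (u i) (u (i + 1)))).toReal)
      (f := fun v => f (u (i + 1)) - f v) (by
        intro v hv
        rw [Set.uIoc_of_le (hmono (Nat.le_succ i))] at hv
        rw [← dist_eq_norm]
        exact (hf.mono (Set.subset_univ _)).dist_le
          (Set.right_mem_Icc.2 (hmono (Nat.le_succ i))) ⟨hv.1.le, hv.2⟩)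
    rw [h1, ← Real.norm_eq_abs]
    rw [hu i, abs_of_nonneg hd] at h2
    linarith
  have hsplit : d * ∑ i ∈ Finset.range n, f (u (i + 1)) - ∫ v in (u 0)..(u n), f v =
      ∑ i ∈ Finset.range n, (d * f (u (i + 1)) - ∫ v in (u i)..(u (i + 1)), f v) := by
    rw [← intervalIntegral.sum_integral_adjacent_intervals (fun i _ => hint _ _),
      Finset.mul_sum, Finset.sum_sub_distrib]
  rw [hsplit]
  calc _ ≤ ∑ i ∈ Finset.range n, |d * f (u (i + 1)) - ∫ v in (u i)..(u (i + 1)), f v| :=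
        Finset.abs_sum_le_sum_abs _ _
    _ ≤ ∑ i ∈ Finset.range n, d * (eVariationOn f (Set.Icc (u i) (u (i + 1)))).toReal :=
        Finset.sum_le_sum fun i _ => hcell i
    _ = d * (eVariationOn f (Set.Icc (u 0) (u n))).toReal := by
        rw [← Finset.mul_sum, ← ENNReal.toReal_sum fun i _ => hfin _, eVariationOn.sum' f hmono]
    _ ≤ d * (eVariationOn f Set.univ).toReal := by
        exact mul_le_mul_of_nonneg_left
          (ENNReal.toReal_mono hf (eVariationOn.mono f (Set.subset_univ _))) hd

/-- The Riemann sums that occur in kernel smoothing over an equispaced design. If the window of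
half-width `R h` about `z` lies in `[0, 1]`, the design covers the support of the summand. -/
lemma abs_designSum_sub_integral_le {f : ℝ → ℝ} (hf : BoundedVariationOn f Set.univ) {R : ℝ}
    (h0 : ∀ u, u ∉ Set.Ioo (-R) R → f u = 0) {n : ℕ} (hn : 0 < n) {h z : ℝ}
    (hh : 0 < h) (hz0 : 0 ≤ z - R * h) (hz1 : z + R * h ≤ 1) :
    |(n * h)⁻¹ * ∑ t, f ((design n t - z) / h) - ∫ u, f u| ≤
      (n * h)⁻¹ * (eVariationOn f Set.univ).toReal := by
  have hn' : (0 : ℝ) < n := by exact_mod_cast hn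
  have key := abs_sum_sub_intervalIntegral_le hf (u := fun i => ((i : ℝ) / n - z) / h)
    (d := (n * h)⁻¹) (by positivity) (fun i => by push_cast; field_simp; ring) n
  have hu0 : (((0 : ℕ) : ℝ) / n - z) / h ≤ -R := by
    rw [div_le_iff₀ hh]; simp; linarith
  have hun : R ≤ ((n : ℝ) / n - z) / h := by
    rw [le_div_iff₀ hh, div_self hn'.ne']; linarith
  have hI : ∫ v in (((0 : ℕ) : ℝ) / n - z) / h..((n : ℝ) / n - z) / h, f v = ∫ u, f u := by
    rw [intervalIntegral.integral_eq_integral_of_support_subset]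
    intro v hv
    have : v ∈ Set.Ioo (-R) R := by
      by_contra hc
      exact hv (h0 v hc)
    exact ⟨hu0.trans_lt this.1, this.2.le.trans hun⟩
  rw [hI, ← Fin.sum_univ_eq_sum_range (fun i : ℕ => f ((((i + 1 : ℕ) : ℝ) / n - z) / h)) n] at key
  simpa [design] using key

/-! ### Kernels and their self-convolution -/

lemma integral_linearCombination {f g k : ℝ → ℝ} (hf : Integrable f) (hg : Integrable g)
    (hk : Integrable k) (a b c : ℝ) : ∫ u, (a * f u + b * g u + c * k u) =
      a * (∫ u, f u) + b * (∫ u, g u) + c * ∫ u, k u := by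
  rw [integral_add (f := fun u => a * f u + b * g u) ((hf.const_mul a).add (hg.const_mul b))
    (hk.const_mul c), integral_add (hf.const_mul a) (hg.const_mul b), integral_const_mul,
    integral_const_mul, integral_const_mul]

namespace IsKernel

variable {K : ℝ → ℝ}

lemma measurable (hK : IsKernel K) : Measurable K :=
  measurable_of_boundedVariationOn hK.boundedVariation

lemma integrable (hK : IsKernel K) : Integrable K :=
  integrable_of_boundedVariationOn hK.boundedVariation hK.eq_zero

/-- Polynomial moments of a kernel exist, since the kernel vanishes off `(-1, 1)`. -/
lemma integrable_pow_mul (hK : IsKernel K) (k : ℕ) : Integrable (fun u => u ^ k * K u) := by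
  refine hK.integrable.mono ((by fun_prop : Measurable fun u : ℝ => u ^ k).mul
    hK.measurable).aestronglyMeasurable (Eventually.of_forall fun u => ?_)
  by_cases hu : u ∈ Set.Ioo (-1 : ℝ) 1
  · rw [norm_mul, norm_pow, Real.norm_eq_abs u]
    exact mul_le_of_le_one_left (norm_nonneg _)
      (pow_le_one₀ (abs_nonneg u) (abs_le.2 ⟨hu.1.le, hu.2.le⟩))
  · simp [hK.eq_zero u hu]

lemma integral_id_mul (hK : IsKernel K) : ∫ u, u * K u = 0 := by
  have h : ∫ u, u * K u = -∫ u, u * K u := by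
    rw [← integral_neg, ← integral_neg_eq_self]
    simp [hK.symm]
  linarith

/-- Reflected translates of a kernel have at most its total variation. -/
lemma eVariationOn_comp_sub_le (a : ℝ) :
    eVariationOn (fun u => K (a - u)) Set.univ ≤ eVariationOn K Set.univ :=
  eVariationOn.comp_le_of_antitoneOn K (fun u => a - u)
    (fun _ _ _ _ h => sub_le_sub_left h a) (Set.mapsTo_univ _ _)

lemma boundedVariationOn_comp_sub (hK : IsKernel K) (a : ℝ) :
    BoundedVariationOn (fun u => K (a - u)) Set.univ :=
  ne_top_of_le_ne_top hK.boundedVariation (eVariationOn_comp_sub_le a)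

lemma integrable_comp_sub_mul (hK : IsKernel K) (u : ℝ) :
    Integrable (fun s => K (s - u) * K s) := by
  obtain ⟨M, -, hM⟩ := exists_abs_le_of_boundedVariationOn hK.boundedVariation
  exact hK.integrable.bdd_mul (c := M)
    (hK.measurable.comp (measurable_id.sub_const u)).aestronglyMeasurable
    (Eventually.of_forall fun s => hM _)

lemma selfConv_eq (hK : IsKernel K) (u : ℝ) : selfConv K u = ∫ s, K s * K (u - s) := by
  refine integral_congr_ae (Eventually.of_forall fun s => ?_)
  show K (s - u) * K s = K s * K (u - s)
  rw [← hK.symm (s - u), neg_sub, mul_comm]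

open scoped Convolution in
lemma selfConv_eq_convolution (hK : IsKernel K) :
    selfConv K = K ⋆[ContinuousLinearMap.mul ℝ ℝ, volume] K := by
  funext u
  rw [hK.selfConv_eq]
  rfl

lemma selfConv_nonneg (hK : IsKernel K) (u : ℝ) : 0 ≤ selfConv K u :=
  integral_nonneg fun _ => mul_nonneg (hK.nonneg _) (hK.nonneg _)

lemma integrable_selfConv (hK : IsKernel K) : Integrable (selfConv K) := by
  rw [hK.selfConv_eq_convolution]
  exact hK.integrable.integrable_convolution _ hK.integrable

lemma integral_selfConv (hK : IsKernel K) : ∫ u, selfConv K u = 1 := by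
  rw [hK.selfConv_eq_convolution, integral_convolution _ hK.integrable hK.integrable]
  simp [hK.integral_eq_one]

lemma selfConv_eq_zero (hK : IsKernel K) {u : ℝ} (hu : u ∉ Set.Ioo (-2 : ℝ) 2) :
    selfConv K u = 0 := by
  rw [selfConv]
  refine integral_eq_zero_of_ae (Eventually.of_forall fun s => ?_)
  by_contra h
  obtain ⟨h1, h2⟩ := mul_ne_zero_iff.1 h
  have h1' : s - u ∈ Set.Ioo (-1 : ℝ) 1 := by
    by_contra hc
    exact h1 (hK.eq_zero _ hc)
  have h2' : s ∈ Set.Ioo (-1 : ℝ) 1 := by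
    by_contra hc
    exact h2 (hK.eq_zero _ hc)
  exact hu ⟨by linarith [h1'.2, h2'.1], by linarith [h1'.1, h2'.2]⟩

/-- The second moment of the self-convolution is twice that of the kernel: expand
`u² = (s + (u - s))²` under the convolution integral; the cross term is a product of first
moments. -/
lemma integral_sq_mul_selfConv (hK : IsKernel K) :
    ∫ u, u ^ 2 * selfConv K u = 2 * ∫ u, u ^ 2 * K u := by
  obtain ⟨M, -, hM⟩ := exists_abs_le_of_boundedVariationOn hK.boundedVariation
  have hi : ∀ k, Integrable (fun u => u ^ k * K u) := hK.integrable_pow_mul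
  set L := ContinuousLinearMap.mul ℝ ℝ
  have hbd : ∀ (j k : ℕ) (u : ℝ),
      Integrable (fun s => (s ^ j * K s) * ((u - s) ^ k * K (u - s))) := by
    intro j k u
    have hm : Measurable fun s : ℝ => (u - s) ^ k * K (u - s) :=
      ((measurable_id.const_sub u).pow_const k).mul (hK.measurable.comp (measurable_id.const_sub u))
    refine (hi j).mul_bdd (c := M) hm.aestronglyMeasurable (Eventually.of_forall fun s => ?_)
    by_cases hu : u - s ∈ Set.Ioo (-1 : ℝ) 1
    · rw [norm_mul, norm_pow, Real.norm_eq_abs (u - s)]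
      exact (mul_le_of_le_one_left (norm_nonneg _)
        (pow_le_one₀ (abs_nonneg _) (abs_le.2 ⟨hu.1.le, hu.2.le⟩))).trans (hM _)
    · simpa [hK.eq_zero _ hu] using (abs_nonneg _).trans (hM 0)
  have hint : ∀ j k : ℕ,
      Integrable (fun u => ∫ s, (s ^ j * K s) * ((u - s) ^ k * K (u - s))) ∧
      ∫ u, ∫ s, (s ^ j * K s) * ((u - s) ^ k * K (u - s)) =
        (∫ s, s ^ j * K s) * ∫ s, s ^ k * K s := fun j k =>
    ⟨(hi j).integrable_convolution L (hi k), integral_convolution L (hi j) (hi k)⟩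
  have hsplit : ∀ u, u ^ 2 * selfConv K u =
      1 * (∫ s, (s ^ 2 * K s) * ((u - s) ^ 0 * K (u - s))) +
      2 * (∫ s, (s ^ 1 * K s) * ((u - s) ^ 1 * K (u - s))) +
      1 * ∫ s, (s ^ 0 * K s) * ((u - s) ^ 2 * K (u - s)) := by
    intro u
    rw [hK.selfConv_eq, ← integral_const_mul,
      ← integral_linearCombination (hbd 2 0 u) (hbd 1 1 u) (hbd 0 2 u)]
    exact integral_congr_ae (Eventually.of_forall fun s => by simp; ring)
  simp_rw [hsplit]
  rw [integral_linearCombination (hint 2 0).1 (hint 1 1).1 (hint 0 2).1,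
    (hint 2 0).2, (hint 1 1).2, (hint 0 2).2]
  simp [hK.integral_eq_one, hK.integral_id_mul]
  ring

/-- Averaging translates of `K` with weight `K` does not increase the total variation. -/
lemma boundedVariationOn_selfConv (hK : IsKernel K) :
    BoundedVariationOn (selfConv K) Set.univ := by
  have hfin : eVariationOn K Set.univ ≠ ∞ := hK.boundedVariation
  refine ne_top_of_le_ne_top hfin (iSup_le ?_)
  rintro ⟨n, u, hu, -⟩
  have hsum : ∀ s, ∑ i ∈ Finset.range n, |K (s - u (i + 1)) - K (s - u i)| ≤
      (eVariationOn K Set.univ).toReal := by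
    intro s
    have h1 : ∑ i ∈ Finset.range n, edist (K (s - u (i + 1))) (K (s - u i)) ≤
        eVariationOn K Set.univ :=
      (eVariationOn.sum_le (f := fun v => K (s - v)) hu fun _ => Set.mem_univ _).trans
        (eVariationOn_comp_sub_le s)
    have h2 := ENNReal.toReal_mono hfin h1
    rw [ENNReal.toReal_sum fun i _ => edist_ne_top _ _] at h2
    simpa [edist_dist, Real.dist_eq] using h2
  have hint : ∀ i, Integrable (fun s => |K (s - u (i + 1)) - K (s - u i)| * K s) := by
    intro i
    refine (((hK.integrable_comp_sub_mul (u (i + 1))).sub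
      (hK.integrable_comp_sub_mul (u i))).abs).congr (Eventually.of_forall fun s => ?_)
    simp [← sub_mul, abs_mul, abs_of_nonneg (hK.nonneg s)]
  have hstep : ∀ i, |selfConv K (u (i + 1)) - selfConv K (u i)| ≤
      ∫ s, |K (s - u (i + 1)) - K (s - u i)| * K s := by
    intro i
    rw [selfConv, selfConv, ← integral_sub (hK.integrable_comp_sub_mul _)
      (hK.integrable_comp_sub_mul _)]
    refine (abs_integral_le_integral_abs).trans_eq
      (integral_congr_ae (Eventually.of_forall fun s => ?_))
    simp [← sub_mul, abs_mul, abs_of_nonneg (hK.nonneg s)]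
  have htot : ∑ i ∈ Finset.range n, |selfConv K (u (i + 1)) - selfConv K (u i)| ≤
      (eVariationOn K Set.univ).toReal := by
    calc _ ≤ ∑ i ∈ Finset.range n, ∫ s, |K (s - u (i + 1)) - K (s - u i)| * K s :=
          Finset.sum_le_sum fun i _ => hstep i
      _ = ∫ s, ∑ i ∈ Finset.range n, |K (s - u (i + 1)) - K (s - u i)| * K s :=
          (integral_finsetSum _ fun i _ => hint i).symm
      _ ≤ ∫ s, (eVariationOn K Set.univ).toReal * K s := by
          refine integral_mono (integrable_finsetSum _ fun i _ => hint i)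
            (hK.integrable.const_mul _) fun s => ?_
          simp only [← Finset.sum_mul]
          exact mul_le_mul_of_nonneg_right (hsum s) (hK.nonneg s)
      _ = _ := by rw [integral_const_mul, hK.integral_eq_one, mul_one]
  calc _ = ∑ i ∈ Finset.range n,
        ENNReal.ofReal |selfConv K (u (i + 1)) - selfConv K (u i)| := by
          simp [edist_dist, Real.dist_eq]
    _ = ENNReal.ofReal (∑ i ∈ Finset.range n, |selfConv K (u (i + 1)) - selfConv K (u i)|) :=
        (ENNReal.ofReal_sum_of_nonneg fun _ _ => abs_nonneg _).symm
    _ ≤ ENNReal.ofReal (eVariationOn K Set.univ).toReal := ENNReal.ofReal_le_ofReal htot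
    _ = _ := ENNReal.ofReal_toReal hfin

end IsKernel

/-! ### The limiting variance as a Gram matrix -/

/-- The function `p K + q (K ∗ K - K)`: the limit, as a function of `(xₜ - x) / h`, of the weight
of the error `εₜ` in `√(nh) (p (Tₙ - Bₙ) + q (B̂ₙ - Bₙ))`. -/
noncomputable def limitWeight (K : ℝ → ℝ) (p q u : ℝ) : ℝ := p * K u + q * (selfConv K u - K u)

namespace IsKernel

variable {K : ℝ → ℝ}

lemma integrable_mul_selfConv (hK : IsKernel K) : Integrable (fun u => K u * selfConv K u) := by
  obtain ⟨M, -, hM⟩ := exists_abs_le_of_boundedVariationOn hK.boundedVariation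
  exact hK.integrable_selfConv.bdd_mul (c := M) hK.measurable.aestronglyMeasurable
    (Eventually.of_forall hM)

lemma integrable_selfConv_sq (hK : IsKernel K) : Integrable (fun u => selfConv K u ^ 2) := by
  obtain ⟨M, -, hM⟩ := exists_abs_le_of_boundedVariationOn hK.boundedVariationOn_selfConv
  simp_rw [pow_two]
  exact hK.integrable_selfConv.bdd_mul (c := M) hK.integrable_selfConv.aestronglyMeasurable
    (Eventually.of_forall hM)

lemma boundedVariationOn_limitWeight (hK : IsKernel K) (p q : ℝ) :
    BoundedVariationOn (limitWeight K p q) Set.univ := by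
  have h : limitWeight K p q = fun u => (p - q) * K u + q * selfConv K u := by
    funext u
    simp [limitWeight]
    ring
  rw [h]
  exact boundedVariationOn_add (boundedVariationOn_const_mul hK.boundedVariation _)
    (boundedVariationOn_const_mul hK.boundedVariationOn_selfConv _)

lemma limitWeight_eq_zero (hK : IsKernel K) (p q : ℝ) {u : ℝ} (hu : u ∉ Set.Ioo (-2 : ℝ) 2) :
    limitWeight K p q u = 0 := by
  have h1 : u ∉ Set.Ioo (-1 : ℝ) 1 := fun h => hu ⟨by linarith [h.1], by linarith [h.2]⟩
  simp [limitWeight, hK.eq_zero u h1, hK.selfConv_eq_zero hu]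

lemma integral_limitWeight_sq (hK : IsKernel K) (s p q : ℝ) :
    s * ∫ u, limitWeight K p q u ^ 2 =
      p ^ 2 * vSq s K + 2 * p * q * (omega12 s K - vSq s K) +
        q ^ 2 * (vSq s K + omega22 s K - 2 * omega12 s K) := by
  have h : ∀ u, limitWeight K p q u ^ 2 = (p - q) ^ 2 * K u ^ 2 +
      2 * (p - q) * q * (K u * selfConv K u) + q ^ 2 * selfConv K u ^ 2 := fun u => by
    simp only [limitWeight]
    ring
  simp_rw [h]
  rw [integral_linearCombination hK.integrable_sq hK.integrable_mul_selfConv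
    hK.integrable_selfConv_sq, vSq, omega12, omega22]
  ring

lemma integrable_limitWeight_sq (hK : IsKernel K) (p q : ℝ) :
    Integrable (fun u => limitWeight K p q u ^ 2) := by
  have h : ∀ u, limitWeight K p q u ^ 2 = (p - q) ^ 2 * K u ^ 2 +
      2 * (p - q) * q * (K u * selfConv K u) + q ^ 2 * selfConv K u ^ 2 := fun u => by
    simp only [limitWeight]
    ring
  simp_rw [h]
  exact ((hK.integrable_sq.const_mul _).add (hK.integrable_mul_selfConv.const_mul _)).add
    (hK.integrable_selfConv_sq.const_mul _)

/-- `K` and `K ∗ K - K` are linearly independent in `L²`: the total mass of `p K + q (K ∗ K - K)`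
is `p`, and its second moment is `(p + q)` times that of `K`. -/
lemma integral_limitWeight_sq_pos (hK : IsKernel K) {p q : ℝ} (hpq : p ≠ 0 ∨ q ≠ 0) :
    0 < ∫ u, limitWeight K p q u ^ 2 := by
  refine lt_of_le_of_ne (integral_nonneg fun u => sq_nonneg _) fun h0 => ?_
  have hae : (fun u => limitWeight K p q u ^ 2) =ᵐ[volume] 0 :=
    (integral_eq_zero_iff_of_nonneg (fun u => sq_nonneg _)
      (hK.integrable_limitWeight_sq p q)).1 h0.symm
  have hae' : limitWeight K p q =ᵐ[volume] 0 := by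
    filter_upwards [hae] with u hu
    exact pow_eq_zero_iff two_ne_zero |>.1 hu
  have hm : Integrable fun u => u ^ 2 * selfConv K u := by
    refine .of_integral_ne_zero ?_
    rw [hK.integral_sq_mul_selfConv]
    exact mul_ne_zero two_ne_zero hK.secondMoment_ne_zero
  have hmass : ∫ u, limitWeight K p q u = p := by
    have h : ∀ u, limitWeight K p q u = (p - q) * K u + q * selfConv K u := fun u => by
      simp only [limitWeight]
      ring
    simp_rw [h]
    rw [integral_add (hK.integrable.const_mul _) (hK.integrable_selfConv.const_mul _),
      integral_const_mul, integral_const_mul, hK.integral_selfConv, hK.integral_eq_one]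
    ring
  have hmom : ∫ u, u ^ 2 * limitWeight K p q u = (p + q) * ∫ u, u ^ 2 * K u := by
    have h : ∀ u, u ^ 2 * limitWeight K p q u =
        (p - q) * (u ^ 2 * K u) + q * (u ^ 2 * selfConv K u) := fun u => by
      simp only [limitWeight]
      ring
    simp_rw [h]
    rw [integral_add ((hK.integrable_pow_mul 2).const_mul _) (hm.const_mul _), integral_const_mul,
      integral_const_mul, hK.integral_sq_mul_selfConv]
    ring
  have hp : p = 0 := by
    rw [← hmass, integral_congr_ae hae']
    simp
  have hq : p + q = 0 := by
    have h1 : ∫ u, u ^ 2 * limitWeight K p q u = 0 := by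
      rw [integral_congr_ae (g := fun _ => 0)]
      · simp
      · filter_upwards [hae'] with u hu
        simp [hu]
    rw [hmom] at h1
    exact (mul_eq_zero.1 h1).resolve_right hK.secondMoment_ne_zero
  rcases hpq with h | h
  · exact h hp
  · exact h (by linarith)

lemma dotProduct_limitVar (hK : IsKernel K) (s : ℝ) (w : Fin 2 → ℝ) :
    w ⬝ᵥ (limitVar s K).mulVec w = s * ∫ u, limitWeight K (w 0) (w 1) u ^ 2 := by
  rw [hK.integral_limitWeight_sq]
  simp [limitVar, dotProduct, Matrix.mulVec, Fin.sum_univ_two]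
  ring

lemma posDef_limitVar (hK : IsKernel K) {s : ℝ} (hs : 0 < s) : (limitVar s K).PosDef := by
  refine Matrix.PosDef.of_dotProduct_mulVec_pos ?_ fun w hw => ?_
  · ext i j
    fin_cases i <;> fin_cases j <;> simp [limitVar]
  · rw [star_trivial, hK.dotProduct_limitVar]
    refine mul_pos hs (hK.integral_limitWeight_sq_pos ?_)
    by_contra! h
    exact hw (funext fun i => by fin_cases i <;> simp [h.1, h.2])

end IsKernel

/-! ### Bandwidth asymptotics -/

lemma bandwidth_pos {c : ℝ} (hc : 0 < c) {n : ℕ} (hn : 0 < n) : 0 < bandwidth c n := by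
  unfold bandwidth
  have : (0 : ℝ) < n := by exact_mod_cast hn
  positivity

lemma bandwidth_nonneg {c : ℝ} (hc : 0 < c) (n : ℕ) : 0 ≤ bandwidth c n := by
  unfold bandwidth
  positivity

lemma tendsto_bandwidth (c : ℝ) : Tendsto (bandwidth c) atTop (𝓝 0) := by
  have h := ((tendsto_rpow_neg_atTop (y := 1 / 5) (by norm_num)).comp
    tendsto_natCast_atTop_atTop).const_mul c
  rw [mul_zero] at h
  exact h

lemma natCast_mul_bandwidth (c : ℝ) {n : ℕ} (hn : 0 < n) :
    (n : ℝ) * bandwidth c n = c * (n : ℝ) ^ (4 / 5 : ℝ) := by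
  have hn' : (0 : ℝ) < n := by exact_mod_cast hn
  have h : (n : ℝ) ^ (4 / 5 : ℝ) = n * (n : ℝ) ^ (-(1 / 5) : ℝ) := by
    nth_rewrite 2 [← Real.rpow_one (n : ℝ)]
    rw [← Real.rpow_add hn']
    norm_num
  rw [bandwidth, h]
  ring

lemma tendsto_natCast_mul_bandwidth {c : ℝ} (hc : 0 < c) :
    Tendsto (fun n : ℕ => (n : ℝ) * bandwidth c n) atTop atTop := by
  have h : Tendsto (fun n : ℕ => c * (n : ℝ) ^ (4 / 5 : ℝ)) atTop atTop :=
    ((tendsto_rpow_atTop (by norm_num)).comp tendsto_natCast_atTop_atTop).const_mul_atTop hc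
  refine h.congr' ?_
  filter_upwards [eventually_gt_atTop 0] with n hn
  exact (natCast_mul_bandwidth c hn).symm

lemma tendsto_inv_mul_natCast_mul_inv (c : ℝ) :
    Tendsto (fun n : ℕ => ((n : ℝ) * bandwidth c n)⁻¹ * n * ((n : ℝ) * bandwidth c n)⁻¹) atTop
      (𝓝 0) := by
  have h := ((tendsto_rpow_neg_atTop (y := 3 / 5) (by norm_num)).comp
    tendsto_natCast_atTop_atTop).const_mul (c⁻¹ * c⁻¹)
  rw [mul_zero] at h
  refine h.congr' ?_
  filter_upwards [eventually_gt_atTop 0] with n hn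
  have hn' : (0 : ℝ) < n := by exact_mod_cast hn
  have e : (n : ℝ) ^ (-(3 / 5) : ℝ) = n * ((n : ℝ) ^ (-(4 / 5) : ℝ) * (n : ℝ) ^ (-(4 / 5) : ℝ)) := by
    nth_rewrite 2 [← Real.rpow_one (n : ℝ)]
    rw [← Real.rpow_add hn', ← Real.rpow_add hn']
    norm_num
  simp only [Function.comp_apply]
  rw [natCast_mul_bandwidth c hn, mul_inv, ← Real.rpow_neg hn'.le, e]
  ring

/-- The rate at which the bias of the smoother varies over a window: `√(nh) h³ → 0`. -/
lemma tendsto_sqrt_mul_bandwidth_cube {c : ℝ} (hc : 0 < c) :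
    Tendsto (fun n : ℕ => √((n : ℝ) * bandwidth c n) * bandwidth c n ^ 3) atTop (𝓝 0) := by
  have h := ((tendsto_rpow_neg_atTop (y := 2 / 5) (by norm_num)).comp
    tendsto_natCast_atTop_atTop).const_mul (c ^ 7)
  rw [mul_zero] at h
  have h2 := (Real.continuous_sqrt.tendsto 0).comp h
  rw [Real.sqrt_zero] at h2
  refine h2.congr' ?_
  filter_upwards [eventually_gt_atTop 0] with n hn
  have hn' : (0 : ℝ) < n := by exact_mod_cast hn
  have e : (n : ℝ) ^ (-(2 / 5) : ℝ) = (n : ℝ) ^ (4 / 5 : ℝ) * ((n : ℝ) ^ (-(1 / 5) : ℝ)) ^ 6 := by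
    rw [← Real.rpow_natCast, ← Real.rpow_mul hn'.le, ← Real.rpow_add hn']
    norm_num
  rw [← Real.sqrt_sq (pow_nonneg (bandwidth_nonneg hc n) 3),
    ← Real.sqrt_mul (mul_nonneg hn'.le (bandwidth_nonneg hc n)), natCast_mul_bandwidth c hn]
  simp only [Function.comp_apply]
  rw [e, bandwidth]
  congr 1
  ring

lemma tendsto_sqrt_mul_inv {c : ℝ} (hc : 0 < c) :
    Tendsto (fun n : ℕ => √((n : ℝ) * bandwidth c n) * ((n : ℝ) * bandwidth c n)⁻¹) atTop
      (𝓝 0) := by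
  have h := tendsto_inv_atTop_zero.comp
    (Real.tendsto_sqrt_atTop.comp (tendsto_natCast_mul_bandwidth hc))
  refine h.congr fun n => ?_
  simp only [Function.comp_apply]
  rw [← div_eq_mul_inv, Real.sqrt_div_self]

/-! ### The bias of the smoother -/

lemma design_mem_Icc {n : ℕ} (t : Fin n) : design n t ∈ Set.Icc (0 : ℝ) 1 := by
  have hn : (0 : ℝ) < n := by exact_mod_cast t.pos
  have ht : ((t : ℕ) : ℝ) + 1 ≤ n := by exact_mod_cast t.isLt
  exact ⟨by unfold design; positivity, by rw [design, div_le_one hn]; exact ht⟩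

lemma nw_add (K : ℝ → ℝ) (c : ℝ) (n : ℕ) (y e : Fin n → ℝ) (z : ℝ) :
    nw K c n (fun t => y t + e t) z = nw K c n y z + nw K c n e z := by
  simp only [nw, mul_add, Finset.sum_add_distrib]

/-- Second-order Taylor expansion about every point near an interior point `x`, with a uniform
cubic remainder and a Lipschitz second-order coefficient. -/
lemma exists_taylor_two {β : ℝ → ℝ} (hβ : ContDiffOn ℝ 3 β (Set.Icc 0 1)) {x : ℝ}
    (hx : x ∈ Set.Ioo (0 : ℝ) 1) :
    ∃ (r C : ℝ) (b₁ b₂ : ℝ → ℝ), 0 < r ∧ 0 ≤ C ∧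
      Set.Icc (x - r) (x + r) ⊆ Set.Icc 0 1 ∧
      (∀ z ∈ Set.Icc (x - r) (x + r), ∀ y ∈ Set.Icc (x - r) (x + r),
        |β y - β z - b₁ z * (y - z) - b₂ z / 2 * (y - z) ^ 2| ≤ C * |y - z| ^ 3) ∧
      ∀ z ∈ Set.Icc (x - r) (x + r), ∀ y ∈ Set.Icc (x - r) (x + r),
        |b₂ y - b₂ z| ≤ C * |y - z| := by
  obtain ⟨r, hr0, hr⟩ : ∃ r > 0, Set.Icc (x - r) (x + r) ⊆ Set.Ioo (0 : ℝ) 1 := by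
    refine ⟨min x (1 - x) / 2, by have := lt_min hx.1 (sub_pos.2 hx.2); linarith, fun y hy => ?_⟩
    have h1 := min_le_left x (1 - x)
    have h2 := min_le_right x (1 - x)
    have h3 := lt_min hx.1 (sub_pos.2 hx.2)
    exact ⟨by linarith [hy.1], by linarith [hy.2]⟩
  have h0 : ContDiffOn ℝ 3 β (Set.Ioo 0 1) := hβ.mono Set.Ioo_subset_Icc_self
  have h1 : ContDiffOn ℝ 2 (deriv β) (Set.Ioo 0 1) := h0.deriv_of_isOpen isOpen_Ioo (by norm_num)
  have h2 : ContDiffOn ℝ 1 (deriv (deriv β)) (Set.Ioo 0 1) :=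
    h1.deriv_of_isOpen isOpen_Ioo (by norm_num)
  have h3 : ContinuousOn (deriv (deriv (deriv β))) (Set.Ioo 0 1) :=
    (h2.deriv_of_isOpen (m := 0) isOpen_Ioo (by norm_num)).continuousOn
  have hd : ∀ {f : ℝ → ℝ} {k : WithTop ℕ∞}, ContDiffOn ℝ k f (Set.Ioo 0 1) → k ≠ 0 →
      ∀ y ∈ Set.Icc (x - r) (x + r), HasDerivAt f (deriv f y) y := fun hf hk y hy =>
    ((hf.contDiffAt (isOpen_Ioo.mem_nhds (hr hy))).differentiableAt hk).hasDerivAt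
  obtain ⟨C, hC⟩ := isCompact_Icc.exists_bound_of_continuousOn (h3.mono hr)
  have hC0 : 0 ≤ C := (norm_nonneg _).trans (hC x ⟨by linarith, by linarith⟩)
  have hlip : ∀ z ∈ Set.Icc (x - r) (x + r), ∀ y ∈ Set.Icc (x - r) (x + r),
      |deriv (deriv β) y - deriv (deriv β) z| ≤ C * |y - z| := fun z hz y hy =>
    (convex_Icc _ _).norm_image_sub_le_of_norm_hasDerivWithin_le
      (fun v hv => (hd h2 (by norm_num) v hv).hasDerivWithinAt) hC hz hy
  -- Each application of the mean value inequality on the segment `[z, y]` integrates once.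
  have hseg : ∀ {z y v : ℝ}, v ∈ Set.uIcc z y → |v - z| ≤ |y - z| := fun hv =>
    Set.abs_sub_left_of_mem_uIcc hv
  have hsub : ∀ {z y : ℝ}, z ∈ Set.Icc (x - r) (x + r) → y ∈ Set.Icc (x - r) (x + r) →
      Set.uIcc z y ⊆ Set.Icc (x - r) (x + r) := fun hz hy => Set.uIcc_subset_Icc hz hy
  have hfirst : ∀ z ∈ Set.Icc (x - r) (x + r), ∀ y ∈ Set.Icc (x - r) (x + r),
      |deriv β y - deriv β z - deriv (deriv β) z * (y - z)| ≤ C * |y - z| ^ 2 := by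
    intro z hz y hy
    have h := (convex_uIcc z y).norm_image_sub_le_of_norm_hasDerivWithin_le
      (f := fun v => deriv β v - deriv (deriv β) z * (v - z))
      (f' := fun v => deriv (deriv β) v - deriv (deriv β) z) (C := C * |y - z|)
      (fun v hv => (((hd h1 (by norm_num) v (hsub hz hy hv)).sub
        (((hasDerivAt_id v).sub_const z).const_mul (deriv (deriv β) z))).congr_deriv
          (by rw [mul_one])).hasDerivWithinAt)
      (fun v hv => (hlip z hz v (hsub hz hy hv)).trans
        (mul_le_mul_of_nonneg_left (hseg hv) hC0))
      Set.left_mem_uIcc Set.right_mem_uIcc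
    simp only [Real.norm_eq_abs, sub_self, mul_zero, sub_zero] at h
    calc _ = |deriv β y - deriv (deriv β) z * (y - z) - deriv β z| := by congr 1; ring
      _ ≤ _ := h
      _ = _ := by ring
  refine ⟨r, C, deriv β, deriv (deriv β), hr0, hC0, hr.trans Set.Ioo_subset_Icc_self, ?_, hlip⟩
  intro z hz y hy
  have h := (convex_uIcc z y).norm_image_sub_le_of_norm_hasDerivWithin_le
    (f := fun v => β v - deriv β z * (v - z) - deriv (deriv β) z / 2 * (v - z) ^ 2)
    (f' := fun v => deriv β v - deriv β z - deriv (deriv β) z * (v - z)) (C := C * |y - z| ^ 2)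
    (fun v hv => by
      have hq := ((hd h0 (by norm_num) v (hsub hz hy hv)).sub
        (((hasDerivAt_id v).sub_const z).const_mul (deriv β z))).sub
        ((((hasDerivAt_id v).sub_const z).pow 2).const_mul (deriv (deriv β) z / 2))
      refine (hq.congr_deriv ?_).hasDerivWithinAt
      simp
      ring)
    (fun v hv => (hfirst z hz v (hsub hz hy hv)).trans
      (mul_le_mul_of_nonneg_left (pow_le_pow_left₀ (abs_nonneg _) (hseg hv) 2) hC0))
    Set.left_mem_uIcc Set.right_mem_uIcc
  simp only [Real.norm_eq_abs, sub_self, mul_zero, sub_zero, ne_eq, OfNat.ofNat_ne_zero,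
    not_false_eq_true, zero_pow] at h
  calc _ = |β y - deriv β z * (y - z) - deriv (deriv β) z / 2 * (y - z) ^ 2 - β z| := by
        congr 1; ring
    _ ≤ _ := h
    _ = _ := by ring

/-- A `C¹` function on `[0, 1]`, extended constantly outside, has bounded variation. -/
lemma boundedVariationOn_IccExtend {β : ℝ → ℝ} (hβ : ContDiffOn ℝ 1 β (Set.Icc 0 1)) :
    BoundedVariationOn (fun v : ℝ => β (max 0 (min 1 v))) Set.univ := by
  obtain ⟨C, hC⟩ := (hβ.locallyLipschitzOn
    (convex_Icc 0 1)).exists_lipschitzOnWith_of_compact isCompact_Icc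
  have hmaps : Set.MapsTo (fun v : ℝ => max 0 (min 1 v)) Set.univ (Set.Icc 0 1) := fun v _ =>
    ⟨le_max_left _ _, max_le zero_le_one (min_le_left _ _)⟩
  have h1 : BoundedVariationOn β (Set.Icc 0 1) :=
    hC.comp_boundedVariationOn (Set.mapsTo_id _) (BoundedVariationOn.id_Icc 0 1)
  exact ne_top_of_le_ne_top h1 (eVariationOn.comp_le_of_monotoneOn β _
    (fun a _ b _ h => max_le_max le_rfl (min_le_min le_rfl h)) hmaps)

/-- The bias of the smoother at points `z` of the window about an interior point `x` is
`h² b(z)` up to the discretization error `1 / (nh)` and a cubic remainder, with `b` Lipschitz. -/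
lemma IsKernel.exists_nw_expansion {K β : ℝ → ℝ} (hK : IsKernel K)
    (hβ : ContDiffOn ℝ 3 β (Set.Icc 0 1)) {x c : ℝ} (hx : x ∈ Set.Ioo (0 : ℝ) 1) (hc : 0 < c) :
    ∃ (C : ℝ) (b : ℝ → ℝ), 0 ≤ C ∧ ∀ᶠ n : ℕ in atTop, ∀ z, |z - x| ≤ bandwidth c n →
      |nw K c n (fun t => β (design n t)) z - β z - bandwidth c n ^ 2 * b z| ≤
        C * ((n * bandwidth c n)⁻¹ + bandwidth c n ^ 3) ∧
      |b z - b x| ≤ C * bandwidth c n := by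
  obtain ⟨r, C₀, b₁, b₂, hr, hC₀, hsub, hT, hL⟩ := exists_taylor_two hβ hx
  have hβ' := boundedVariationOn_IccExtend (hβ.of_le (by norm_num))
  set γ : ℝ → ℝ := fun v => β (max 0 (min 1 v)) with hγ
  have hγ_eq : ∀ v ∈ Set.Icc (0 : ℝ) 1, γ v = β v := fun v hv => by
    simp only [hγ]
    rw [min_eq_right hv.2, max_eq_right hv.1]
  obtain ⟨B, hB0, hB⟩ := exists_abs_le_of_boundedVariationOn hβ'
  obtain ⟨M, hM0, hM⟩ := exists_abs_le_of_boundedVariationOn hK.boundedVariation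
  set TK := (eVariationOn K Set.univ).toReal
  set Tγ := (eVariationOn γ Set.univ).toReal
  set m₂ := ∫ u, u ^ 2 * K u
  have hTK : 0 ≤ TK := ENNReal.toReal_nonneg
  have hTγ : 0 ≤ Tγ := ENNReal.toReal_nonneg
  refine ⟨(M * Tγ + B * TK) + C₀ + C₀ * |m₂ / 2|, fun z => m₂ / 2 * b₂ z, by positivity, ?_⟩
  have hsmall : ∀ᶠ n : ℕ in atTop, bandwidth c n < r / 2 :=
    (tendsto_bandwidth c).eventually_lt_const (by linarith)
  filter_upwards [eventually_gt_atTop 0, hsmall] with n hn hhr z hz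
  have hn' : (0 : ℝ) < n := by exact_mod_cast hn
  have hh := bandwidth_pos hc hn
  set h := bandwidth c n with hh_def
  obtain ⟨hz1, hz2⟩ := abs_le.1 hz
  have hzI : z ∈ Set.Icc (x - r) (x + r) := ⟨by linarith, by linarith⟩
  have hxI : x ∈ Set.Icc (x - r) (x + r) := ⟨by linarith, by linarith⟩
  have hlo := (hsub (⟨le_rfl, by linarith⟩ : x - r ∈ Set.Icc (x - r) (x + r))).1
  have hhi := (hsub (⟨by linarith, le_rfl⟩ : x + r ∈ Set.Icc (x - r) (x + r))).2
  have hNinv : 0 ≤ (n * h)⁻¹ := by positivity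
  refine ⟨?_, ?_⟩
  · -- The summand as a function of the rescaled design points has bounded variation.
    have hgmono : eVariationOn (fun u => γ (z + h * u)) Set.univ ≤ eVariationOn γ Set.univ :=
      eVariationOn.comp_le_of_monotoneOn γ (fun u => z + h * u)
        (fun a _ b _ hab => by dsimp only; gcongr) (Set.mapsTo_univ _ _)
    have hgbv : BoundedVariationOn (fun u => γ (z + h * u)) Set.univ :=
      ne_top_of_le_ne_top hβ' hgmono
    have hfbv : BoundedVariationOn (fun u => K u * γ (z + h * u)) Set.univ :=
      hK.boundedVariation.fun_mul hgbv
    have hfz : ∀ u, u ∉ Set.Ioo (-1 : ℝ) 1 → K u * γ (z + h * u) = 0 := fun u hu => by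
      rw [hK.eq_zero u hu, zero_mul]
    have hriem := abs_designSum_sub_integral_le hfbv hfz hn hh (z := z) (by linarith)
      (by linarith)
    have htv : (eVariationOn (fun u => K u * γ (z + h * u)) Set.univ).toReal ≤
        M * Tγ + B * TK :=
      (boundedVariationOn_mul_toReal_le hK.boundedVariation hgbv hM fun u => hB _).trans
        (add_le_add (mul_le_mul_of_nonneg_left (ENNReal.toReal_mono hβ' hgmono) hM0) le_rfl)
    have hsum : (n * h)⁻¹ * ∑ t, K ((design n t - z) / h) * γ (z + h * ((design n t - z) / h)) =
        nw K c n (fun t => β (design n t)) z := by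
      rw [nw]
      refine congrArg _ (Finset.sum_congr rfl fun t _ => ?_)
      rw [mul_div_cancel₀ _ hh.ne', add_sub_cancel, hγ_eq _ (design_mem_Icc t)]
    rw [hsum] at hriem
    have hint := integrable_of_boundedVariationOn hfbv hfz
    have htaylor : |(∫ u, K u * γ (z + h * u)) - β z - h ^ 2 * (m₂ / 2 * b₂ z)| ≤
        C₀ * h ^ 3 := by
      have hlin : ∫ u, (β z * K u + b₁ z * h * (u * K u) + b₂ z / 2 * h ^ 2 * (u ^ 2 * K u)) =
          β z + h ^ 2 * (m₂ / 2 * b₂ z) := by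
        rw [integral_linearCombination hK.integrable (by simpa using hK.integrable_pow_mul 1)
          (hK.integrable_pow_mul 2), hK.integral_eq_one, hK.integral_id_mul]
        ring
      have hlin_int : Integrable fun u => β z * K u + b₁ z * h * (u * K u) +
          b₂ z / 2 * h ^ 2 * (u ^ 2 * K u) :=
        ((hK.integrable.const_mul _).add
          ((by simpa using hK.integrable_pow_mul 1 : Integrable fun u => u * K u).const_mul _)).add
          ((hK.integrable_pow_mul 2).const_mul _)
      rw [sub_sub, ← hlin, ← integral_sub hint hlin_int]
      have hbound := norm_integral_le_of_norm_le (μ := volume) (hK.integrable.const_mul (C₀ * h ^ 3))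
        (f := fun u => K u * γ (z + h * u) - (β z * K u + b₁ z * h * (u * K u) +
          b₂ z / 2 * h ^ 2 * (u ^ 2 * K u))) (Eventually.of_forall fun u => ?_)
      · rwa [integral_const_mul, hK.integral_eq_one, mul_one] at hbound
      · by_cases hu : u ∈ Set.Ioo (-1 : ℝ) 1
        · have hy1 : -h ≤ h * u := by nlinarith [hu.1]
          have hy2 : h * u ≤ h := by nlinarith [hu.2]
          have hyI : z + h * u ∈ Set.Icc (x - r) (x + r) := ⟨by linarith, by linarith⟩
          rw [hγ_eq _ (hsub hyI)]
          have ht := hT z hzI _ hyI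
          rw [add_sub_cancel_left, abs_mul, abs_of_pos hh] at ht
          have hu1 : |u| ≤ 1 := abs_le.2 ⟨hu.1.le, hu.2.le⟩
          have ht' : C₀ * (h * |u|) ^ 3 ≤ C₀ * h ^ 3 := by
            gcongr
            exact mul_le_of_le_one_right hh.le hu1
          have hfac : K u * β (z + h * u) - (β z * K u + b₁ z * h * (u * K u) +
              b₂ z / 2 * h ^ 2 * (u ^ 2 * K u)) =
              K u * (β (z + h * u) - β z - b₁ z * (h * u) - b₂ z / 2 * (h * u) ^ 2) := by ring
          rw [hfac, norm_mul, Real.norm_eq_abs, Real.norm_eq_abs, abs_of_nonneg (hK.nonneg u),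
            mul_comm]
          exact mul_le_mul_of_nonneg_right (ht.trans ht') (hK.nonneg u)
        · simp [hK.eq_zero u hu]
    have htri := abs_add_le (nw K c n (fun t => β (design n t)) z - ∫ u, K u * γ (z + h * u))
      ((∫ u, K u * γ (z + h * u)) - β z - h ^ 2 * (m₂ / 2 * b₂ z))
    have heq : nw K c n (fun t => β (design n t)) z - β z - h ^ 2 * (m₂ / 2 * b₂ z) =
        (nw K c n (fun t => β (design n t)) z - ∫ u, K u * γ (z + h * u)) +
          ((∫ u, K u * γ (z + h * u)) - β z - h ^ 2 * (m₂ / 2 * b₂ z)) := by ring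
    rw [heq]
    have hriem' := hriem.trans (mul_le_mul_of_nonneg_left htv hNinv)
    have p1 : 0 ≤ (M * Tγ + B * TK) * h ^ 3 := by positivity
    have p2 : 0 ≤ C₀ * (n * h)⁻¹ := by positivity
    have p3 : 0 ≤ C₀ * |m₂ / 2| * ((n * h)⁻¹ + h ^ 3) := by positivity
    nlinarith
  · have hl := hL x hxI z hzI
    rw [← mul_sub, abs_mul]
    have h1 : |m₂ / 2| * |b₂ z - b₂ x| ≤ |m₂ / 2| * (C₀ * h) :=
      mul_le_mul_of_nonneg_left (hl.trans (mul_le_mul_of_nonneg_left hz hC₀)) (abs_nonneg _)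
    have p1 : 0 ≤ (M * Tγ + B * TK + C₀) * h := by positivity
    nlinarith

lemma IsKernel.eventually_abs_designSum_sub_one_le {K : ℝ → ℝ} (hK : IsKernel K) {x c : ℝ}
    (hx : x ∈ Set.Ioo (0 : ℝ) 1) (hc : 0 < c) :
    ∀ᶠ n : ℕ in atTop, |(n * bandwidth c n)⁻¹ * ∑ t, K ((design n t - x) / bandwidth c n) - 1| ≤
      (n * bandwidth c n)⁻¹ * (eVariationOn K Set.univ).toReal := by
  filter_upwards [eventually_gt_atTop 0,
    (tendsto_bandwidth c).eventually_lt_const (lt_min hx.1 (sub_pos.2 hx.2))] with n hn hh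
  have h := abs_designSum_sub_integral_le hK.boundedVariation hK.eq_zero hn (bandwidth_pos hc hn)
    (z := x) (by linarith [hh.trans_le (min_le_left _ _)])
    (by linarith [hh.trans_le (min_le_right _ _)])
  rwa [hK.integral_eq_one] at h

/-- Smoothing the bias once more changes it negligibly: the deterministic part of `B̂ₙ - Bₙ`
tends to `0`. The leading term `h² b` of the bias is nearly constant over the window. -/
lemma IsKernel.tendsto_smoothed_bias_sub {K β : ℝ → ℝ} (hK : IsKernel K)
    (hβ : ContDiffOn ℝ 3 β (Set.Icc 0 1)) {x c : ℝ} (hx : x ∈ Set.Ioo (0 : ℝ) 1) (hc : 0 < c) :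
    Tendsto (fun n : ℕ => √(n * bandwidth c n) *
      (nw K c n (fun t => nw K c n (fun s => β (design n s)) (design n t)) x -
        nw K c n (fun t => β (design n t)) x -
        (nw K c n (fun t => β (design n t)) x - β x))) atTop (𝓝 0) := by
  obtain ⟨C, b, hC, hexp⟩ := hK.exists_nw_expansion hβ hx hc
  set T := (eVariationOn K Set.univ).toReal
  have hT : 0 ≤ T := ENNReal.toReal_nonneg
  set A := (1 + T) * (3 * C) + (2 * C + |b x|) * T
  have hlim : Tendsto (fun n : ℕ => A * (√(n * bandwidth c n) * (n * bandwidth c n)⁻¹ +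
      √(n * bandwidth c n) * bandwidth c n ^ 3)) atTop (𝓝 0) := by
    simpa using ((tendsto_sqrt_mul_inv hc).add (tendsto_sqrt_mul_bandwidth_cube hc)).const_mul A
  refine squeeze_zero_norm' ?_ hlim
  filter_upwards [eventually_gt_atTop 0, hexp, hK.eventually_abs_designSum_sub_one_le hx hc,
    (tendsto_bandwidth c).eventually_lt_const one_pos,
    (tendsto_natCast_mul_bandwidth hc).eventually_ge_atTop 1] with n hn hexp hmass hh1 hN1
  have hh := bandwidth_pos hc hn
  set h := bandwidth c n
  set N := (n : ℝ) * h
  have hN0 : 0 < N := by linarith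
  have hNi : N⁻¹ ≤ 1 := inv_le_one_of_one_le₀ hN1
  have hNi0 : 0 < N⁻¹ := inv_pos.2 hN0
  have hh3 : h ^ 3 ≤ 1 := pow_le_one₀ hh.le hh1.le
  have hh2 : h ^ 2 ≤ 1 := pow_le_one₀ hh.le hh1.le
  have hh30 : 0 < h ^ 3 := by positivity
  set ρ : ℝ → ℝ := fun z => nw K c n (fun t => β (design n t)) z - β z with hρ
  have hdiff : ∀ z, |z - x| ≤ h → |ρ z - ρ x| ≤ 3 * C * (N⁻¹ + h ^ 3) := by
    intro z hz
    obtain ⟨e1, e2⟩ := hexp z hz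
    obtain ⟨e3, -⟩ := hexp x (by simpa using hh.le)
    have e4 : |h ^ 2 * b z - h ^ 2 * b x| ≤ C * h ^ 3 := by
      rw [← mul_sub, abs_mul, abs_of_pos (by positivity : 0 < h ^ 2)]
      calc h ^ 2 * |b z - b x| ≤ h ^ 2 * (C * h) := by gcongr
        _ = _ := by ring
    have e5 : ρ z - ρ x = (ρ z - h ^ 2 * b z) - (ρ x - h ^ 2 * b x) +
        (h ^ 2 * b z - h ^ 2 * b x) := by ring
    have e6 := abs_add_le ((ρ z - h ^ 2 * b z) - (ρ x - h ^ 2 * b x)) (h ^ 2 * b z - h ^ 2 * b x)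
    have e7 := abs_sub (ρ z - h ^ 2 * b z) (ρ x - h ^ 2 * b x)
    rw [e5]
    have e8 : 0 ≤ C * N⁻¹ := by positivity
    simp only [hρ] at *
    linarith
  have hρx : |ρ x| ≤ 2 * C + |b x| := by
    obtain ⟨e3, -⟩ := hexp x (by simpa using hh.le)
    have e4 := abs_add_le (ρ x - h ^ 2 * b x) (h ^ 2 * b x)
    rw [sub_add_cancel, abs_mul, abs_of_pos (by positivity : 0 < h ^ 2)] at e4
    have e5 : h ^ 2 * |b x| ≤ |b x| := mul_le_of_le_one_left (abs_nonneg _) hh2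
    have e6 : C * (N⁻¹ + h ^ 3) ≤ C * 2 := by gcongr; linarith
    simp only [hρ] at *
    linarith
  set k : Fin n → ℝ := fun t => K ((design n t - x) / h) with hk
  have hdecomp : nw K c n (fun t => nw K c n (fun s => β (design n s)) (design n t)) x -
        nw K c n (fun t => β (design n t)) x - (nw K c n (fun t => β (design n t)) x - β x) =
      N⁻¹ * ∑ t, k t * (ρ (design n t) - ρ x) + ρ x * (N⁻¹ * ∑ t, k t - 1) := by
    have h1 : nw K c n (fun t => nw K c n (fun s => β (design n s)) (design n t)) x -
        nw K c n (fun t => β (design n t)) x = N⁻¹ * ∑ t, k t * ρ (design n t) := by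
      rw [nw, nw, ← mul_sub, ← Finset.sum_sub_distrib]
      simp only [hρ, ← mul_sub]
      rfl
    rw [h1]
    simp only [mul_sub, Finset.sum_sub_distrib, ← Finset.sum_mul]
    ring
  have hfirst : |N⁻¹ * ∑ t, k t * (ρ (design n t) - ρ x)| ≤
      (1 + T) * (3 * C * (N⁻¹ + h ^ 3)) := by
    have hterm : ∀ t, |k t * (ρ (design n t) - ρ x)| ≤ k t * (3 * C * (N⁻¹ + h ^ 3)) := by
      intro t
      rw [abs_mul, abs_of_nonneg (hK.nonneg _)]
      by_cases hu : (design n t - x) / h ∈ Set.Ioo (-1 : ℝ) 1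
      · refine mul_le_mul_of_nonneg_left (hdiff _ ?_) (hK.nonneg _)
        have h1 := (lt_div_iff₀ hh).1 hu.1
        have h2 := (div_lt_iff₀ hh).1 hu.2
        exact abs_le.2 ⟨by linarith, by linarith⟩
      · simp [hk, hK.eq_zero _ hu]
    rw [abs_mul, abs_of_pos hNi0]
    calc _ ≤ N⁻¹ * ∑ t, k t * (3 * C * (N⁻¹ + h ^ 3)) := by
          gcongr
          exact (Finset.abs_sum_le_sum_abs _ _).trans (Finset.sum_le_sum fun t _ => hterm t)
      _ = (N⁻¹ * ∑ t, k t) * (3 * C * (N⁻¹ + h ^ 3)) := by rw [← Finset.sum_mul]; ring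
      _ ≤ _ := by
          gcongr
          have h1 := (abs_le.1 hmass).2
          have h2 : N⁻¹ * T ≤ T := mul_le_of_le_one_left hT hNi
          linarith
  have hsecond : |ρ x * (N⁻¹ * ∑ t, k t - 1)| ≤ (2 * C + |b x|) * (N⁻¹ * T) := by
    rw [abs_mul]
    exact mul_le_mul hρx hmass (abs_nonneg _) (by positivity)
  rw [hdecomp, norm_mul, Real.norm_eq_abs, Real.norm_eq_abs, abs_of_nonneg (Real.sqrt_nonneg _),
    ← mul_add]
  have htot := abs_add_le (N⁻¹ * ∑ t, k t * (ρ (design n t) - ρ x)) (ρ x * (N⁻¹ * ∑ t, k t - 1))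
  have hbd : |N⁻¹ * ∑ t, k t * (ρ (design n t) - ρ x) + ρ x * (N⁻¹ * ∑ t, k t - 1)| ≤
      A * (N⁻¹ + h ^ 3) := by
    have p : 0 ≤ (2 * C + |b x|) * T * h ^ 3 := by positivity
    simp only [A]
    nlinarith
  calc _ ≤ √N * (A * (N⁻¹ + h ^ 3)) := mul_le_mul_of_nonneg_left hbd (Real.sqrt_nonneg _)
    _ = _ := by ring

/-! ### Error weights -/

/-- The weight `(nh)⁻¹ ∑ₜ kₜ K((xₛ - xₜ) / h)` of the `s`-th error in the smoother applied
twice. -/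
noncomputable def smoothedWeight (K : ℝ → ℝ) (c x : ℝ) (n : ℕ) (s : Fin n) : ℝ :=
  (n * bandwidth c n)⁻¹ * ∑ t : Fin n,
    K ((design n t - x) / bandwidth c n) * K ((design n s - design n t) / bandwidth c n)

/-- The weight of the `s`-th error in the random part of `√(nh) (p (Tₙ - Bₙ) + q (B̂ₙ - Bₙ))`. -/
noncomputable def errorWeight (K : ℝ → ℝ) (c x p q : ℝ) (n : ℕ) (s : Fin n) : ℝ :=
  p * K ((design n s - x) / bandwidth c n) +
    q * (smoothedWeight K c x n s - K ((design n s - x) / bandwidth c n))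

lemma nw_nw_eq (K : ℝ → ℝ) (c x : ℝ) (n : ℕ) (e : Fin n → ℝ) :
    nw K c n (fun t => nw K c n e (design n t)) x =
      (n * bandwidth c n)⁻¹ * ∑ s, smoothedWeight K c x n s * e s := by
  simp only [nw, smoothedWeight, Finset.mul_sum, Finset.sum_mul]
  rw [Finset.sum_comm]
  refine congrArg _ (funext fun s => Finset.sum_congr rfl fun t _ => ?_)
  ring

lemma IsKernel.eventually_abs_smoothedWeight_sub_le {K : ℝ → ℝ} (hK : IsKernel K) {x c : ℝ}
    (hx : x ∈ Set.Ioo (0 : ℝ) 1) (hc : 0 < c) :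
    ∃ C : ℝ, 0 ≤ C ∧ ∀ᶠ n : ℕ in atTop, ∀ s : Fin n,
      |smoothedWeight K c x n s - selfConv K ((design n s - x) / bandwidth c n)| ≤
        C * (n * bandwidth c n)⁻¹ := by
  obtain ⟨M, hM0, hM⟩ := exists_abs_le_of_boundedVariationOn hK.boundedVariation
  set T := (eVariationOn K Set.univ).toReal
  have hT : 0 ≤ T := ENNReal.toReal_nonneg
  refine ⟨M * T + M * T, by positivity, ?_⟩
  filter_upwards [eventually_gt_atTop 0,
    (tendsto_bandwidth c).eventually_lt_const (lt_min hx.1 (sub_pos.2 hx.2))] with n hn hh s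
  have hh0 := bandwidth_pos hc hn
  have hn' : (0 : ℝ) < n := by exact_mod_cast hn
  set h := bandwidth c n
  set u := (design n s - x) / h
  have hbv := hK.boundedVariationOn_comp_sub u
  have hfz : ∀ v, v ∉ Set.Ioo (-1 : ℝ) 1 → K v * K (u - v) = 0 := fun v hv => by
    rw [hK.eq_zero v hv, zero_mul]
  have hriem := abs_designSum_sub_integral_le (hK.boundedVariation.fun_mul hbv) hfz hn hh0 (z := x)
    (by linarith [hh.trans_le (min_le_left _ _)]) (by linarith [hh.trans_le (min_le_right _ _)])
  have htv : (eVariationOn (fun v => K v * K (u - v)) Set.univ).toReal ≤ M * T + M * T :=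
    (boundedVariationOn_mul_toReal_le hK.boundedVariation hbv hM fun v => hM _).trans
      (add_le_add (mul_le_mul_of_nonneg_left
        (ENNReal.toReal_mono hK.boundedVariation (IsKernel.eVariationOn_comp_sub_le u)) hM0) le_rfl)
  rw [← hK.selfConv_eq] at hriem
  have hw : smoothedWeight K c x n s =
      (n * h)⁻¹ * ∑ t, K ((design n t - x) / h) * K (u - (design n t - x) / h) := by
    rw [smoothedWeight]
    refine congrArg _ (Finset.sum_congr rfl fun t _ => ?_)
    rw [← sub_div, sub_sub_sub_cancel_right]
  rw [hw, mul_comm (M * T + M * T)]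
  exact hriem.trans (mul_le_mul_of_nonneg_left htv (by positivity))

/-- The error weights are uniformly bounded, and their normalized sum of squares converges: they
differ from `limitWeight` at the rescaled design points by `O(1 / (nh))` uniformly, and
`n / (nh)² → 0`. -/
lemma IsKernel.errorWeight_asymptotics {K : ℝ → ℝ} (hK : IsKernel K) {x c : ℝ}
    (hx : x ∈ Set.Ioo (0 : ℝ) 1) (hc : 0 < c) (p q : ℝ) :
    (∃ B : ℝ, ∀ᶠ n : ℕ in atTop, ∀ s, |errorWeight K c x p q n s| ≤ B) ∧
    Tendsto (fun n : ℕ => (n * bandwidth c n)⁻¹ * ∑ s, errorWeight K c x p q n s ^ 2) atTop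
      (𝓝 (∫ u, limitWeight K p q u ^ 2)) := by
  obtain ⟨C, hC0, hC⟩ := hK.eventually_abs_smoothedWeight_sub_le hx hc
  have hbv := hK.boundedVariationOn_limitWeight p q
  obtain ⟨B, hB0, hB⟩ := exists_abs_le_of_boundedVariationOn hbv
  have hclose : ∀ᶠ n : ℕ in atTop, ∀ s : Fin n,
      |errorWeight K c x p q n s - limitWeight K p q ((design n s - x) / bandwidth c n)| ≤
        |q| * C * (n * bandwidth c n)⁻¹ := by
    filter_upwards [hC] with n hn s
    have h : errorWeight K c x p q n s - limitWeight K p q ((design n s - x) / bandwidth c n) =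
        q * (smoothedWeight K c x n s - selfConv K ((design n s - x) / bandwidth c n)) := by
      rw [errorWeight, limitWeight]
      ring
    rw [h, abs_mul, mul_assoc]
    exact mul_le_mul_of_nonneg_left (hn s) (abs_nonneg q)
  have hbound : ∀ᶠ n : ℕ in atTop, ∀ s, |errorWeight K c x p q n s| ≤ |q| * C + B := by
    filter_upwards [hclose, (tendsto_natCast_mul_bandwidth hc).eventually_ge_atTop 1] with n hn hN s
    have h1 := abs_add_le
      (errorWeight K c x p q n s - limitWeight K p q ((design n s - x) / bandwidth c n))
      (limitWeight K p q ((design n s - x) / bandwidth c n))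
    rw [sub_add_cancel] at h1
    have h2 : |q| * C * (n * bandwidth c n)⁻¹ ≤ |q| * C :=
      mul_le_of_le_one_right (by positivity) (inv_le_one_of_one_le₀ hN)
    linarith [hn s, hB ((design n s - x) / bandwidth c n)]
  refine ⟨⟨_, hbound⟩, ?_⟩
  have hlimit : Tendsto (fun n : ℕ => (n * bandwidth c n)⁻¹ *
      ∑ s, limitWeight K p q ((design n s - x) / bandwidth c n) ^ 2) atTop
      (𝓝 (∫ u, limitWeight K p q u ^ 2)) := by
    have hbv2 : BoundedVariationOn (fun u => limitWeight K p q u ^ 2) Set.univ := by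
      simp_rw [pow_two]
      exact hbv.fun_mul hbv
    rw [tendsto_iff_norm_sub_tendsto_zero]
    have h0 := (tendsto_inv_atTop_zero.comp (tendsto_natCast_mul_bandwidth hc)).mul_const
      (eVariationOn (fun u => limitWeight K p q u ^ 2) Set.univ).toReal
    rw [zero_mul] at h0
    refine squeeze_zero' (Eventually.of_forall fun n => norm_nonneg _) ?_ h0
    filter_upwards [eventually_gt_atTop 0, (tendsto_bandwidth c).eventually_lt_const
      (half_pos (lt_min hx.1 (sub_pos.2 hx.2)))] with n hn hh
    exact abs_designSum_sub_integral_le hbv2 (R := 2)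
      (fun u hu => by rw [hK.limitWeight_eq_zero p q hu]; simp) hn (bandwidth_pos hc hn)
      (by linarith [min_le_left x (1 - x)]) (by linarith [min_le_right x (1 - x)])
  have hdiff : Tendsto (fun n : ℕ => (n * bandwidth c n)⁻¹ * ∑ s, errorWeight K c x p q n s ^ 2 -
      (n * bandwidth c n)⁻¹ *
        ∑ s, limitWeight K p q ((design n s - x) / bandwidth c n) ^ 2) atTop (𝓝 0) := by
    have h0 := (tendsto_inv_mul_natCast_mul_inv c).const_mul (|q| * C * (|q| * C + B + B))
    rw [mul_zero] at h0
    refine squeeze_zero_norm' ?_ h0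
    filter_upwards [eventually_gt_atTop 0, hclose, hbound] with n hn hcl hbd
    have hh0 := bandwidth_pos hc hn
    have hn' : (0 : ℝ) < n := by exact_mod_cast hn
    rw [← mul_sub, ← Finset.sum_sub_distrib, norm_mul, Real.norm_eq_abs, Real.norm_eq_abs,
      abs_of_nonneg (by positivity : 0 ≤ ((n : ℝ) * bandwidth c n)⁻¹)]
    have hsum : |∑ s, (errorWeight K c x p q n s ^ 2 -
        limitWeight K p q ((design n s - x) / bandwidth c n) ^ 2)| ≤
        n * (|q| * C * (n * bandwidth c n)⁻¹ * (|q| * C + B + B)) := by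
      have hterm : ∀ s ∈ (Finset.univ : Finset (Fin n)), |errorWeight K c x p q n s ^ 2 -
          limitWeight K p q ((design n s - x) / bandwidth c n) ^ 2| ≤
          |q| * C * (n * bandwidth c n)⁻¹ * (|q| * C + B + B) := by
        intro s _
        rw [sq_sub_sq, abs_mul, mul_comm]
        exact mul_le_mul (hcl s) ((abs_add_le _ _).trans (add_le_add (hbd s) (hB _)))
          (abs_nonneg _) (by positivity)
      refine (Finset.abs_sum_le_sum_abs _ _).trans ((Finset.sum_le_card_nsmul _ _ _ hterm).trans_eq ?_)
      simp
    calc _ ≤ (n * bandwidth c n)⁻¹ *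
          (n * (|q| * C * (n * bandwidth c n)⁻¹ * (|q| * C + B + B))) := by gcongr
      _ = _ := by ring
  simpa using hdiff.add hlimit

/-! ### A central limit theorem for weighted sums -/

lemma norm_prod_sub_prod_le {ι : Type*} (s : Finset ι) {f g : ι → ℂ} (hf : ∀ i, ‖f i‖ ≤ 1)
    (hg : ∀ i, ‖g i‖ ≤ 1) : ‖∏ i ∈ s, f i - ∏ i ∈ s, g i‖ ≤ ∑ i ∈ s, ‖f i - g i‖ := by
  classical
  induction s using Finset.induction_on with
  | empty => simp
  | insert a s ha ih =>
    rw [Finset.prod_insert ha, Finset.prod_insert ha, Finset.sum_insert ha]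
    have h1 : ‖∏ i ∈ s, f i‖ ≤ 1 := by
      rw [norm_prod]
      exact Finset.prod_le_one (fun i _ => norm_nonneg _) fun i _ => hf i
    calc _ = ‖(f a - g a) * ∏ i ∈ s, f i + g a * (∏ i ∈ s, f i - ∏ i ∈ s, g i)‖ := by
          congr 1
          ring
      _ ≤ ‖f a - g a‖ * ‖∏ i ∈ s, f i‖ + ‖g a‖ * ‖∏ i ∈ s, f i - ∏ i ∈ s, g i‖ := by
          refine (norm_add_le _ _).trans ?_
          rw [norm_mul, norm_mul]
      _ ≤ ‖f a - g a‖ * 1 + 1 * ∑ i ∈ s, ‖f i - g i‖ := by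
          gcongr
          exact hg a
      _ = _ := by ring

namespace IsErrorSequence

variable {Ω : Type*} [MeasurableSpace Ω] {P : Measure Ω} {ε : ℕ → Ω → ℝ} {σ : ℝ}

lemma integral_sq (hε : IsErrorSequence P ε σ) : ∫ ω, ε 0 ω ^ 2 ∂P = σ ^ 2 := by
  rw [← hε.variance, variance_of_integral_eq_zero (hε.measurable 0).aemeasurable hε.mean]

lemma integrable_sq [IsProbabilityMeasure P] (hε : IsErrorSequence P ε σ) (hσ : 0 < σ) :
    Integrable (fun ω => ε 0 ω ^ 2) P := by
  refine .of_integral_ne_zero ?_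
  rw [hε.integral_sq]
  positivity

/-- Near `0` the characteristic function of the errors agrees with that of `N(0, σ²)` up to
`o(t²)`. -/
lemma charFun_sub_isLittleO [IsProbabilityMeasure P] (hε : IsErrorSequence P ε σ) (hσ : 0 < σ) :
    (fun t : ℝ => charFun (P.map (ε 0)) t - Complex.exp (-(σ ^ 2 * t ^ 2 / 2 : ℝ))) =o[𝓝 0]
      fun t : ℝ => t ^ 2 := by
  have hm := (hε.measurable 0).aemeasurable (μ := P)
  have hL2 : MemLp id 2 (P.map (ε 0)) := by
    rw [memLp_two_iff_integrable_sq (by fun_prop)]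
    exact (integrable_map_measure (by fun_prop) hm).2 (hε.integrable_sq hσ)
  have : IsProbabilityMeasure (P.map (ε 0)) := Measure.isProbabilityMeasure_map hm
  have h1 := taylor_isLittleO_univ (x₀ := 0) (contDiff_charFun (n := 2) hL2)
  have h2 : (fun t : ℝ => Complex.exp (-(σ ^ 2 * t ^ 2 / 2 : ℝ)) - (1 - (σ ^ 2 * t ^ 2 / 2 : ℝ)))
      =o[𝓝 0] fun t : ℝ => t ^ 2 := by
    have hd := (Complex.hasDerivAt_exp 0).isLittleO
    have ht : Tendsto (fun t : ℝ => (-(σ ^ 2 * t ^ 2 / 2 : ℝ) : ℂ)) (𝓝 0) (𝓝 0) := by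
      have : Continuous fun t : ℝ => (-(σ ^ 2 * t ^ 2 / 2 : ℝ) : ℂ) := by fun_prop
      simpa using this.tendsto 0
    have hc := hd.comp_tendsto ht
    refine (hc.congr_left fun t => ?_).trans_isBigO ?_
    · simp
      ring
    · refine Asymptotics.IsBigO.of_bound (σ ^ 2 / 2) (Eventually.of_forall fun t => ?_)
      simp
      apply le_of_eq
      ring
  refine (h1.sub (h2.congr_right fun t => by simp)).congr (fun t => ?_) (fun t => by simp)
  rw [taylorWithinEval_charFun_two_zero hm hL2, show P[ε 0 ^ 2] = σ ^ 2 from hε.integral_sq,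
    hε.mean]
  push_cast
  ring

/-- If `max |aₛ| → 0` and `∑ aₛ² → τ` then the characteristic function of `∑ aₛ εₛ` at `1` tends to
`exp (-σ² τ / 2)`: compare the product of characteristic functions factor by factor with that of
independent normal variables. -/
lemma tendsto_charFun_weightedSum [IsProbabilityMeasure P] (hε : IsErrorSequence P ε σ)
    (hσ : 0 < σ) {a : ∀ n : ℕ, Fin n → ℝ} {η : ℕ → ℝ} (hη : Tendsto η atTop (𝓝 0))
    (ha : ∀ᶠ n in atTop, ∀ s, |a n s| ≤ η n) {τ : ℝ}
    (hτ : Tendsto (fun n => ∑ s, a n s ^ 2) atTop (𝓝 τ)) :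
    Tendsto (fun n => charFun (P.map fun ω => ∑ s, a n s * ε s ω) 1) atTop
      (𝓝 (Complex.exp (-(σ ^ 2 * τ / 2 : ℝ)))) := by
  have hprod : ∀ n, charFun (P.map fun ω => ∑ s, a n s * ε s ω) 1 =
      ∏ s, charFun (P.map (ε 0)) (a n s) := by
    intro n
    have hind : iIndepFun (fun (s : Fin n) ω => a n s * ε s ω) P :=
      (hε.indep.precomp Fin.val_injective).comp (fun s y => a n s * y)
        fun s => measurable_const_mul _
    have h := iIndepFun.charFun_map_fun_finsetSum_eq_prod (s := Finset.univ)
      (X := fun (s : Fin n) ω => a n s * ε s ω)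
      (fun s _ => ((hε.measurable s).const_mul _).aemeasurable)
      (hind.restrict _)
    rw [h, Finset.prod_apply]
    refine Finset.prod_congr rfl fun s _ => ?_
    rw [charFun_map_mul_comp (hε.measurable s).aemeasurable, mul_one, (hε.identDistrib s).map_eq]
  have hgauss : Tendsto (fun n => ∏ s, Complex.exp (-(σ ^ 2 * a n s ^ 2 / 2 : ℝ))) atTop
      (𝓝 (Complex.exp (-(σ ^ 2 * τ / 2 : ℝ)))) := by
    have h : ∀ n, ∏ s, Complex.exp (-(σ ^ 2 * a n s ^ 2 / 2 : ℝ)) =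
        Complex.exp (-(σ ^ 2 * (∑ s, a n s ^ 2) / 2 : ℝ)) := by
      intro n
      rw [← Complex.exp_sum, Finset.mul_sum, Finset.sum_div]
      push_cast
      rw [Finset.sum_neg_distrib]
    simp_rw [h]
    have hcont : Continuous fun v : ℝ => Complex.exp (-(σ ^ 2 * v / 2 : ℝ)) := by fun_prop
    exact (hcont.tendsto τ).comp hτ
  have hdiff : Tendsto (fun n => ∏ s, charFun (P.map (ε 0)) (a n s) -
      ∏ s, Complex.exp (-(σ ^ 2 * a n s ^ 2 / 2 : ℝ))) atTop (𝓝 0) := by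
    rw [Metric.tendsto_nhds]
    intro δ hδ
    simp only [dist_zero_right]
    have hτ1 : 0 < |τ| + 1 := by positivity
    have hev := (hε.charFun_sub_isLittleO hσ).bound (div_pos hδ hτ1)
    obtain ⟨r, hr, hball⟩ := Metric.eventually_nhds_iff.1 hev
    filter_upwards [ha, hη.eventually_lt_const hr,
      hτ.eventually_lt_const ((le_abs_self τ).trans_lt (lt_add_one _))] with n han hηn hτn
    have hm := (hε.measurable 0).aemeasurable (μ := P)
    have : IsProbabilityMeasure (P.map (ε 0)) := Measure.isProbabilityMeasure_map hm
    refine (norm_prod_sub_prod_le _ (fun s => norm_charFun_le_one _) fun s => ?_).trans_lt ?_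
    · rw [Complex.norm_exp, Complex.neg_re, Complex.ofReal_re, Real.exp_le_one_iff]
      have : 0 ≤ σ ^ 2 * a n s ^ 2 / 2 := by positivity
      linarith
    · calc _ ≤ ∑ s, δ / (|τ| + 1) * a n s ^ 2 := by
            refine Finset.sum_le_sum fun s _ => ?_
            have h := hball (y := a n s) (by
              rw [dist_zero_right, Real.norm_eq_abs]
              exact (han s).trans_lt hηn)
            rwa [Real.norm_of_nonneg (sq_nonneg (a n s))] at h
        _ = δ / (|τ| + 1) * ∑ s, a n s ^ 2 := by rw [Finset.mul_sum]
        _ < δ / (|τ| + 1) * (|τ| + 1) := by gcongr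
        _ = δ := div_mul_cancel₀ _ hτ1.ne'
  simp_rw [hprod]
  simpa using hdiff.add hgauss

end IsErrorSequence

/-! ### Normal distribution functions -/

/-- The value at `u` of the distribution function of `N(0, a)`. The variance `a` is a real number
so that continuity in it can be stated; for `a ≤ 0` the law is the point mass at `0`. -/
noncomputable def normalCdf (a u : ℝ) : ℝ := (gaussianReal 0 a.toNNReal).real (Set.Iic u)

lemma continuous_normalCdf {a : ℝ} (ha : 0 < a) : Continuous (normalCdf a) := by
  have hv : a.toNNReal ≠ 0 := (Real.toNNReal_pos.2 ha).ne'
  have hint := integrable_gaussianPDFReal 0 a.toNNReal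
  have h : normalCdf a = fun u => ∫ y in Set.Iic u, gaussianPDFReal 0 a.toNNReal y := by
    funext u
    rw [normalCdf, measureReal_def, gaussianReal_apply_eq_integral 0 hv, ENNReal.toReal_ofReal]
    exact setIntegral_nonneg measurableSet_Iic fun y _ => gaussianPDFReal_nonneg _ _ y
  rw [h, continuous_iff_continuousAt]
  intro u
  exact (IntegrableOn.continuousOn_Iic_primitive_Iic (a₀ := u + 1)
    hint.integrableOn).continuousAt (Iic_mem_nhds (lt_add_one u))

lemma strictMono_normalCdf {a : ℝ} (ha : 0 < a) : StrictMono (normalCdf a) := by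
  intro u v huv
  have hv : a.toNNReal ≠ 0 := (Real.toNNReal_pos.2 ha).ne'
  have h1 : (gaussianReal 0 a.toNNReal).real (Set.Iic v) =
      normalCdf a u + (gaussianReal 0 a.toNNReal).real (Set.Ioc u v) := by
    rw [normalCdf, ← measureReal_union (Set.Iic_disjoint_Ioc le_rfl) measurableSet_Ioc,
      Set.Iic_union_Ioc_eq_Iic huv.le]
  have h2 : 0 < (gaussianReal 0 a.toNNReal).real (Set.Ioc u v) := by
    rw [measureReal_def, ENNReal.toReal_pos_iff]
    refine ⟨pos_iff_ne_zero.2 fun h0 => ?_, measure_lt_top _ _⟩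
    have := gaussianReal_absolutelyContinuous' 0 hv h0
    rw [Real.volume_Ioc, ENNReal.ofReal_eq_zero] at this
    linarith
  rw [show normalCdf a v = _ from h1]
  linarith

lemma normalCdf_eq_div_sqrt {a : ℝ} (ha : 0 < a) (u : ℝ) :
    normalCdf a u = normalCdf 1 (u / √a) := by
  have hs : 0 < √a := Real.sqrt_pos.2 ha
  have h : gaussianReal 0 a.toNNReal = (gaussianReal 0 (1 : ℝ).toNNReal).map (√a * ·) := by
    rw [gaussianReal_map_const_mul, mul_zero]
    congr 1
    ext
    simp [Real.sq_sqrt ha.le, ha.le]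
  rw [normalCdf, h, map_measureReal_apply (measurable_const_mul _) measurableSet_Iic, normalCdf]
  congr 1
  ext y
  simp [le_div_iff₀ hs, mul_comm]

lemma continuousAt_normalCdf_variance {a : ℝ} (ha : 0 < a) (u : ℝ) :
    ContinuousAt (fun b => normalCdf b u) a := by
  have h : ContinuousAt (fun b => normalCdf 1 (u / √b)) a :=
    (continuous_normalCdf one_pos).continuousAt.comp (continuousAt_const.div
      Real.continuous_sqrt.continuousAt (Real.sqrt_pos.2 ha).ne')
  refine h.congr ?_
  filter_upwards [lt_mem_nhds ha] with b hb
  exact (normalCdf_eq_div_sqrt hb u).symm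

lemma measurable_sum_mul {n : ℕ} (b : Fin n → ℝ) :
    Measurable fun e : Fin n → ℝ => ∑ t, b t * e t :=
  Finset.measurable_fun_sum _ fun t _ =>
    (measurable_pi_apply t : Measurable fun e : Fin n → ℝ => e t).const_mul (b t)

/-- A linear form in independent `N(0, v)` variables is `N(0, v ∑ bₜ²)`. -/
lemma map_pi_gaussianReal_linear {n : ℕ} (v : ℝ≥0) (b : Fin n → ℝ) :
    (Measure.pi fun _ : Fin n => gaussianReal 0 v).map (fun e => ∑ t, b t * e t) =
      gaussianReal 0 ((v : ℝ) * ∑ t, b t ^ 2).toNNReal := by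
  have : IsProbabilityMeasure ((Measure.pi fun _ : Fin n => gaussianReal 0 v).map
      fun e : Fin n → ℝ => ∑ t, b t * e t) :=
    Measure.isProbabilityMeasure_map (measurable_sum_mul b).aemeasurable
  refine Measure.ext_of_charFun (funext fun r => ?_)
  have hind : iIndepFun (fun (t : Fin n) (e : Fin n → ℝ) => b t * e t)
      (Measure.pi fun _ : Fin n => gaussianReal 0 v) :=
    iIndepFun_pi (X := fun t y => b t * y) fun t => (measurable_const_mul _).aemeasurable
  have h := iIndepFun.charFun_map_fun_finsetSum_eq_prod (s := Finset.univ)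
    (X := fun (t : Fin n) (e : Fin n → ℝ) => b t * e t)
    (fun t _ => ((measurable_pi_apply t).const_mul _).aemeasurable) (hind.restrict _)
  have hmarg : ∀ t : Fin n, (Measure.pi fun _ : Fin n => gaussianReal 0 v).map
      (fun e : Fin n → ℝ => e t) = gaussianReal 0 v := fun t => (measurePreserving_eval _ t).map_eq
  have hnn : 0 ≤ (v : ℝ) * ∑ t, b t ^ 2 :=
    mul_nonneg v.2 (Finset.sum_nonneg fun _ _ => sq_nonneg _)
  rw [h, Finset.prod_apply, charFun_gaussianReal, Real.coe_toNNReal _ hnn]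
  have hfac : ∀ t : Fin n, charFun ((Measure.pi fun _ : Fin n => gaussianReal 0 v).map
      fun e : Fin n → ℝ => b t * e t) r = Complex.exp (-((v : ℂ) * (b t) ^ 2 * r ^ 2 / 2)) := by
    intro t
    rw [charFun_map_mul_comp (measurable_pi_apply t).aemeasurable, hmarg, charFun_gaussianReal]
    congr 1
    push_cast
    ring
  simp_rw [hfac]
  rw [← Complex.exp_sum]
  congr 1
  push_cast
  rw [Finset.sum_neg_distrib, ← Finset.sum_div, ← Finset.sum_mul, ← Finset.mul_sum]
  ring

section Law

variable {Ω' : Type*} [MeasurableSpace Ω'] {P' : Measure Ω'}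

/-- Linear forms in a bivariate centered normal vector are normal. -/
lemma hasLaw_linear_of_hasLaw_multivariateGaussian {V : Matrix (Fin 2) (Fin 2) ℝ}
    (hV : V.PosSemidef) {ξ₁ ξ₂ : Ω' → ℝ}
    (hξ : HasLaw (fun ω' => !₂[ξ₁ ω', ξ₂ ω']) (multivariateGaussian 0 V) P') (w : Fin 2 → ℝ) :
    HasLaw (fun ω' => w 0 * ξ₁ ω' + w 1 * ξ₂ ω')
      (gaussianReal 0 (w ⬝ᵥ V.mulVec w).toNNReal) P' := by
  have hlin : HasLaw (fun v : EuclideanSpace ℝ (Fin 2) => w 0 * v 0 + w 1 * v 1)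
      (gaussianReal 0 (w ⬝ᵥ V.mulVec w).toNNReal) (multivariateGaussian 0 V) := by
    refine ⟨by fun_prop, ?_⟩
    have : IsProbabilityMeasure ((multivariateGaussian 0 V).map
        fun v : EuclideanSpace ℝ (Fin 2) => w 0 * v 0 + w 1 * v 1) :=
      Measure.isProbabilityMeasure_map (by fun_prop)
    refine Measure.ext_of_charFun (funext fun r => ?_)
    have hinner : ∀ v : EuclideanSpace ℝ (Fin 2),
        inner ℝ v (WithLp.toLp 2 (r • w)) = r * (w 0 * v 0 + w 1 * v 1) := by
      intro v
      simp [PiLp.inner_apply, Fin.sum_univ_two]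
      ring
    have hleft : charFun ((multivariateGaussian 0 V).map
        fun v : EuclideanSpace ℝ (Fin 2) => w 0 * v 0 + w 1 * v 1) r =
        charFun (multivariateGaussian 0 V) (WithLp.toLp 2 (r • w)) := by
      rw [charFun_apply_real, charFun_apply, integral_map (by fun_prop) (by fun_prop)]
      simp_rw [hinner]
      push_cast
      rfl
    have hnn : 0 ≤ w ⬝ᵥ V.mulVec w := by simpa using hV.dotProduct_mulVec_nonneg w
    rw [hleft, charFun_multivariateGaussian hV, charFun_gaussianReal, Real.coe_toNNReal _ hnn]
    congr 1
    simp [Matrix.mulVec_smul]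
    ring
  exact hlin.comp hξ

variable {X : Ω' → ℝ} {a : ℝ}

lemma measureReal_le_eq_normalCdf (hX : HasLaw X (gaussianReal 0 a.toNNReal) P') (u : ℝ) :
    P'.real {ω' | X ω' ≤ u} = normalCdf a u :=
  hX.measureReal_eq (p := fun y => y ≤ u) measurableSet_Iic

lemma integrable_of_hasLaw_gaussianReal (hX : HasLaw X (gaussianReal 0 a.toNNReal) P') :
    Integrable X P' := by
  have h : Integrable id (P'.map X) := by
    rw [hX.map_eq]
    exact memLp_one_iff_integrable.1 (memLp_id_gaussianReal 1)
  exact (integrable_map_measure (by fun_prop) hX.aemeasurable).1 h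

lemma integral_eq_zero_of_hasLaw_gaussianReal
    (hX : HasLaw X (gaussianReal 0 a.toNNReal) P') : ∫ ω', X ω' ∂P' = 0 := by
  rw [hX.integral_eq, integral_id_gaussianReal]

end Law

/-! ### Decomposition of the statistics -/

section Decomposition

variable (K β : ℝ → ℝ) (c x : ℝ)

lemma stat_sub_bias {Ω : Type*} (ε : ℕ → Ω → ℝ) (n : ℕ) (ω : Ω) :
    stat K c β x n (sample β ε n ω) - bias K c β x n =
      √(n * bandwidth c n) * nw K c n (fun t => ε t ω) x := by
  rw [stat, bias, show nw K c n (sample β ε n ω) x = nw K c n (fun t => β (design n t)) x +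
    nw K c n (fun t => ε t ω) x from nw_add _ _ _ _ _ _]
  ring

lemma bootStat_sub_bootBias (n : ℕ) (y e : Fin n → ℝ) :
    bootStat K c x n y e - bootBias K c x n y = √(n * bandwidth c n) * nw K c n e x := by
  rw [bootStat, bootBias, show nw K c n (bootSample K c n y e) x =
    nw K c n (fun t => nw K c n y (design n t)) x + nw K c n e x from nw_add _ _ _ _ _ _]
  ring

lemma bootBias_sub_bias {Ω : Type*} (ε : ℕ → Ω → ℝ) (n : ℕ) (ω : Ω) :
    bootBias K c x n (sample β ε n ω) - bias K c β x n =
      √(n * bandwidth c n) * (nw K c n (fun t => nw K c n (fun s => ε s ω) (design n t)) x -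
        nw K c n (fun t => ε t ω) x) +
      √(n * bandwidth c n) *
        (nw K c n (fun t => nw K c n (fun s => β (design n s)) (design n t)) x -
          nw K c n (fun t => β (design n t)) x -
          (nw K c n (fun t => β (design n t)) x - β x)) := by
  have h : ∀ z, nw K c n (sample β ε n ω) z = nw K c n (fun t => β (design n t)) z +
    nw K c n (fun t => ε t ω) z := fun z => nw_add _ _ _ _ _ _
  rw [bootBias, bias]
  simp_rw [h]
  rw [nw_add]
  ring

lemma sqrt_mul_nw_combination (p q : ℝ) (n : ℕ) (e : Fin n → ℝ) :
    p * (√(n * bandwidth c n) * nw K c n e x) + q * (√(n * bandwidth c n) *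
      (nw K c n (fun t => nw K c n e (design n t)) x - nw K c n e x)) =
    ∑ s, (√(n * bandwidth c n) * (n * bandwidth c n)⁻¹ * errorWeight K c x p q n s) * e s := by
  have h : ∑ s, (√(n * bandwidth c n) * (n * bandwidth c n)⁻¹ * errorWeight K c x p q n s) * e s =
      √(n * bandwidth c n) * (n * bandwidth c n)⁻¹ *
        (p * ∑ s, K ((design n s - x) / bandwidth c n) * e s +
          q * (∑ s, smoothedWeight K c x n s * e s -
            ∑ s, K ((design n s - x) / bandwidth c n) * e s)) := by
    rw [← Finset.sum_sub_distrib, Finset.mul_sum, Finset.mul_sum, ← Finset.sum_add_distrib,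
      Finset.mul_sum]
    refine Finset.sum_congr rfl fun s _ => ?_
    rw [errorWeight]
    ring
  rw [h, nw_nw_eq, nw]
  ring

lemma measurable_nw (n : ℕ) (z : ℝ) : Measurable fun y : Fin n → ℝ => nw K c n y z := by
  unfold nw
  fun_prop

lemma measurable_bootBias (n : ℕ) : Measurable (bootBias K c x n) := by
  unfold bootBias
  exact (((measurable_nw K c n x).comp (measurable_pi_lambda _ fun t =>
    measurable_nw K c n (design n t))).sub (measurable_nw K c n x)).const_mul _

end Decomposition

lemma IsErrorSequence.measurable_sample {Ω : Type*} [MeasurableSpace Ω] {P : Measure Ω}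
    {ε : ℕ → Ω → ℝ} {σ : ℝ} (hε : IsErrorSequence P ε σ) (β : ℝ → ℝ) (n : ℕ) :
    Measurable (sample β ε n) :=
  measurable_pi_lambda _ fun t => (hε.measurable t).const_add _

/-- The scaled error weights satisfy the conditions of the central limit theorem. -/
lemma IsKernel.scaled_errorWeight_asymptotics {K : ℝ → ℝ} (hK : IsKernel K) {x c : ℝ}
    (hx : x ∈ Set.Ioo (0 : ℝ) 1) (hc : 0 < c) (p q : ℝ) :
    (∃ η : ℕ → ℝ, Tendsto η atTop (𝓝 0) ∧ ∀ᶠ n : ℕ in atTop, ∀ s,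
      |√(n * bandwidth c n) * (n * bandwidth c n)⁻¹ * errorWeight K c x p q n s| ≤ η n) ∧
    Tendsto (fun n : ℕ =>
      ∑ s, (√(n * bandwidth c n) * (n * bandwidth c n)⁻¹ * errorWeight K c x p q n s) ^ 2) atTop
      (𝓝 (∫ u, limitWeight K p q u ^ 2)) := by
  obtain ⟨⟨B, hB⟩, hlim⟩ := hK.errorWeight_asymptotics hx hc p q
  have hN : ∀ n : ℕ, 0 ≤ (n : ℝ) * bandwidth c n := fun n =>
    mul_nonneg (Nat.cast_nonneg n) (bandwidth_nonneg hc n)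
  refine ⟨⟨fun n => √(n * bandwidth c n) * (n * bandwidth c n)⁻¹ * B,
    by simpa using (tendsto_sqrt_mul_inv hc).mul_const B, ?_⟩, ?_⟩
  · filter_upwards [hB] with n hn s
    have h0 : 0 ≤ √(n * bandwidth c n) * (n * bandwidth c n)⁻¹ :=
      mul_nonneg (Real.sqrt_nonneg _) (inv_nonneg.2 (hN n))
    rw [abs_mul, abs_of_nonneg h0]
    exact mul_le_mul_of_nonneg_left (hn s) h0
  · refine hlim.congr fun n => ?_
    simp only [mul_pow]
    rw [← Finset.mul_sum, Real.sq_sqrt (hN n), pow_two, ← mul_assoc]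
    rcases (hN n).eq_or_lt with h | h
    · simp [← h]
    · rw [mul_inv_cancel₀ h.ne', one_mul]

/-! ### Continuity of the limiting variance -/

lemma integrable_mul_of_memLp_two {f g : ℝ → ℝ} (hf : MemLp f 2) (hg : MemLp g 2) :
    Integrable (fun u => f u * g u) :=
  hf.integrable_mul hg

lemma abs_integral_mul_le_sqrt_mul_sqrt {f g : ℝ → ℝ} (hf : MemLp f 2) (hg : MemLp g 2) :
    |∫ u, f u * g u| ≤ √(∫ u, f u ^ 2) * √(∫ u, g u ^ 2) := by
  have h := integral_mul_norm_le_Lp_mul_Lq (μ := volume) (f := f) (g := g)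
    Real.HolderConjugate.two_two (by simpa using hf) (by simpa using hg)
  have h1 : |∫ u, f u * g u| ≤ ∫ u, ‖f u‖ * ‖g u‖ := by
    refine (abs_integral_le_integral_abs).trans_eq ?_
    simp [abs_mul]
  refine (h1.trans h).trans_eq ?_
  simp [Real.sqrt_eq_rpow]

namespace IsKernel

variable {K κ : ℝ → ℝ}

lemma memLp_two (hK : IsKernel K) : MemLp K 2 :=
  (memLp_two_iff_integrable_sq hK.measurable.aestronglyMeasurable).2 hK.integrable_sq

lemma memLp_two_selfConv (hK : IsKernel K) : MemLp (selfConv K) 2 :=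
  (memLp_two_iff_integrable_sq hK.integrable_selfConv.aestronglyMeasurable).2
    hK.integrable_selfConv_sq

lemma abs_integral_sq_sub_le (hκ : IsKernel κ) (hK : IsKernel K) :
    |(∫ u, κ u ^ 2) - ∫ u, K u ^ 2| ≤
      √(∫ u, (κ u - K u) ^ 2) * (√(∫ u, κ u ^ 2) + √(∫ u, K u ^ 2)) := by
  have hd : MemLp (fun u => κ u - K u) 2 := hκ.memLp_two.sub hK.memLp_two
  have h : (∫ u, κ u ^ 2) - ∫ u, K u ^ 2 =
      (∫ u, (κ u - K u) * κ u) + ∫ u, (κ u - K u) * K u := by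
    rw [← integral_sub hκ.integrable_sq hK.integrable_sq,
      ← integral_add (integrable_mul_of_memLp_two hd hκ.memLp_two)
        (integrable_mul_of_memLp_two hd hK.memLp_two)]
    exact integral_congr_ae (Eventually.of_forall fun u => by ring)
  rw [h, mul_add]
  exact (abs_add_le _ _).trans (add_le_add (abs_integral_mul_le_sqrt_mul_sqrt hd hκ.memLp_two)
    (abs_integral_mul_le_sqrt_mul_sqrt hd hK.memLp_two))

/-- Self-convolution is locally Lipschitz from `L²` to the uniform norm. -/
lemma abs_selfConv_sub_le (hκ : IsKernel κ) (hK : IsKernel K) (u : ℝ) :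
    |selfConv κ u - selfConv K u| ≤
      √(∫ u, (κ u - K u) ^ 2) * (√(∫ u, κ u ^ 2) + √(∫ u, K u ^ 2)) := by
  have hshift : ∀ {f : ℝ → ℝ}, MemLp f 2 → MemLp (fun s => f (s - u)) 2 := fun hf =>
    hf.comp_measurePreserving (measurePreserving_sub_right volume u)
  have hd : MemLp (fun u => κ u - K u) 2 := hκ.memLp_two.sub hK.memLp_two
  have h : selfConv κ u - selfConv K u = (∫ s, (κ s - K s) * κ (s - u)) +
      ∫ s, (κ (s - u) - K (s - u)) * K s := by
    rw [selfConv, selfConv, ← integral_sub (hκ.integrable_comp_sub_mul u)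
      (hK.integrable_comp_sub_mul u), ← integral_add
        (integrable_mul_of_memLp_two hd (hshift hκ.memLp_two))
        (integrable_mul_of_memLp_two (hshift hd) hK.memLp_two)]
    exact integral_congr_ae (Eventually.of_forall fun s => by ring)
  have e1 := abs_integral_mul_le_sqrt_mul_sqrt hd (hshift hκ.memLp_two)
  have e2 := abs_integral_mul_le_sqrt_mul_sqrt (hshift hd) hK.memLp_two
  rw [integral_sub_right_eq_self (fun s => κ s ^ 2) u] at e1
  rw [integral_sub_right_eq_self (fun s => (κ s - K s) ^ 2) u] at e2
  rw [h, mul_add]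
  exact (abs_add_le _ _).trans (add_le_add e1 e2)

/-- `V` depends continuously on the error variance and, in `L²`, on the kernel. Uniform convergence
of the self-convolutions suffices for `ω₁₂` and `ω₂₂`, because kernels and their self-convolutions
are nonnegative with integral one. -/
lemma tendsto_limitVar (hK : IsKernel K) {σ2 : ℝ} {s : ℕ → ℝ} {κ : ℕ → ℝ → ℝ}
    (hs : Tendsto s atTop (𝓝 σ2)) (hκ : ∀ m, IsKernel (κ m))
    (hlim : Tendsto (fun m => ∫ u, (κ m u - K u) ^ 2) atTop (𝓝 0)) :
    Tendsto (fun m => limitVar (s m) (κ m)) atTop (𝓝 (limitVar σ2 K)) := by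
  set d : ℕ → ℝ := fun m => √(∫ u, (κ m u - K u) ^ 2)
  have hd : Tendsto d atTop (𝓝 0) := by
    have h := (Real.continuous_sqrt.tendsto 0).comp hlim
    rwa [Real.sqrt_zero] at h
  set R := √(∫ u, K u ^ 2)
  -- The triangle inequality in `L²`, by expanding `∫ κ² = ∫ ((κ - K) + K)²`.
  have hnorm : ∀ m, √(∫ u, κ m u ^ 2) ≤ d m + R := by
    intro m
    have hdm : MemLp (fun u => κ m u - K u) 2 := (hκ m).memLp_two.sub hK.memLp_two
    have h : ∫ u, κ m u ^ 2 = 1 * (∫ u, (κ m u - K u) ^ 2) +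
        2 * (∫ u, (κ m u - K u) * K u) + 1 * ∫ u, K u ^ 2 := by
      rw [← integral_linearCombination hdm.integrable_sq
        (integrable_mul_of_memLp_two hdm hK.memLp_two)
        hK.integrable_sq]
      exact integral_congr_ae (Eventually.of_forall fun u => by ring)
    have hcs := (le_abs_self _).trans (abs_integral_mul_le_sqrt_mul_sqrt hdm hK.memLp_two)
    have e1 : d m ^ 2 = ∫ u, (κ m u - K u) ^ 2 :=
      Real.sq_sqrt (integral_nonneg fun u => sq_nonneg _)
    have e2 : R ^ 2 = ∫ u, K u ^ 2 := Real.sq_sqrt (integral_nonneg fun u => sq_nonneg _)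
    have e3 : 0 ≤ d m := Real.sqrt_nonneg _
    have e4 : 0 ≤ R := Real.sqrt_nonneg _
    rw [Real.sqrt_le_left (by positivity), h]
    nlinarith
  set D : ℕ → ℝ := fun m => d m * (d m + R + R)
  have hD : Tendsto D atTop (𝓝 0) := by
    simpa using hd.mul ((hd.add_const R).add_const R)
  have hDbound : ∀ m, d m * (√(∫ u, κ m u ^ 2) + R) ≤ D m := fun m =>
    mul_le_mul_of_nonneg_left (add_le_add (hnorm m) le_rfl) (Real.sqrt_nonneg _)
  have hsup : ∀ m u, |selfConv (κ m) u - selfConv K u| ≤ D m := fun m u =>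
    ((hκ m).abs_selfConv_sub_le hK u).trans (hDbound m)
  have hv : Tendsto (fun m => ∫ u, κ m u ^ 2) atTop (𝓝 (∫ u, K u ^ 2)) := by
    rw [tendsto_iff_norm_sub_tendsto_zero]
    exact squeeze_zero (fun _ => norm_nonneg _)
      (fun m => ((hκ m).abs_integral_sq_sub_le hK).trans (hDbound m)) hD
  have h12 : Tendsto (fun m => ∫ u, κ m u * selfConv (κ m) u) atTop
      (𝓝 (∫ u, K u * selfConv K u)) := by
    rw [tendsto_iff_norm_sub_tendsto_zero]
    refine squeeze_zero (fun _ => norm_nonneg _) (fun m => ?_)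
      (g := fun m => D m + d m * √(∫ u, selfConv K u ^ 2)) (by
        simpa using hD.add (hd.mul_const (√(∫ u, selfConv K u ^ 2))))
    have hdm : MemLp (fun u => κ m u - K u) 2 := (hκ m).memLp_two.sub hK.memLp_two
    have hdc : MemLp (fun u => selfConv (κ m) u - selfConv K u) 2 :=
      (hκ m).memLp_two_selfConv.sub hK.memLp_two_selfConv
    have h : (∫ u, κ m u * selfConv (κ m) u) - ∫ u, K u * selfConv K u =
        (∫ u, κ m u * (selfConv (κ m) u - selfConv K u)) + ∫ u, (κ m u - K u) * selfConv K u := by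
      rw [← integral_sub (hκ m).integrable_mul_selfConv hK.integrable_mul_selfConv,
        ← integral_add (integrable_mul_of_memLp_two (hκ m).memLp_two hdc)
          (integrable_mul_of_memLp_two hdm hK.memLp_two_selfConv)]
      exact integral_congr_ae (Eventually.of_forall fun u => by ring)
    rw [h]
    refine (norm_add_le _ _).trans (add_le_add ?_
      (abs_integral_mul_le_sqrt_mul_sqrt hdm hK.memLp_two_selfConv))
    have hb := norm_integral_le_of_norm_le (μ := volume) ((hκ m).integrable.const_mul (D m))
      (f := fun u => κ m u * (selfConv (κ m) u - selfConv K u)) (Eventually.of_forall fun u => by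
        rw [norm_mul, Real.norm_eq_abs, abs_of_nonneg ((hκ m).nonneg u), mul_comm]
        exact mul_le_mul_of_nonneg_right (hsup m u) ((hκ m).nonneg u))
    rwa [integral_const_mul, (hκ m).integral_eq_one, mul_one] at hb
  have h22 : Tendsto (fun m => ∫ u, selfConv (κ m) u ^ 2) atTop (𝓝 (∫ u, selfConv K u ^ 2)) := by
    rw [tendsto_iff_norm_sub_tendsto_zero]
    refine squeeze_zero (fun _ => norm_nonneg _) (fun m => ?_) (g := fun m => D m * 2) (by
      simpa using hD.mul_const 2)
    rw [← integral_sub (hκ m).integrable_selfConv_sq hK.integrable_selfConv_sq]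
    have hint : Integrable fun u => selfConv (κ m) u + selfConv K u :=
      (hκ m).integrable_selfConv.add hK.integrable_selfConv
    have hb := norm_integral_le_of_norm_le (μ := volume) (hint.const_mul (D m))
      (f := fun u => selfConv (κ m) u ^ 2 - selfConv K u ^ 2) (Eventually.of_forall fun u => by
        have hn : 0 ≤ selfConv (κ m) u + selfConv K u :=
          add_nonneg ((hκ m).selfConv_nonneg u) (hK.selfConv_nonneg u)
        rw [sq_sub_sq, norm_mul, Real.norm_of_nonneg hn, mul_comm]
        exact mul_le_mul_of_nonneg_right (hsup m u) hn)
    rwa [integral_const_mul, integral_add (hκ m).integrable_selfConv hK.integrable_selfConv,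
      (hκ m).integral_selfConv, hK.integral_selfConv, one_add_one_eq_two] at hb
  have hv' := hs.mul hv
  have h12' := hs.mul h12
  have h22' := hs.mul h22
  refine tendsto_pi_nhds.2 fun i => tendsto_pi_nhds.2 fun j => ?_
  fin_cases i <;> fin_cases j
  · exact hv'
  · exact h12'.sub hv'
  · exact h12'.sub hv'
  · exact (hv'.add h22').sub (h12'.const_mul 2)

end IsKernel

/-! ### Joint convergence of the statistic and the bootstrap bias -/

/-- By the Cramér–Wold device in terms of characteristic functions: every linear form in
`(Tₙ - Bₙ, B̂ₙ - Bₙ)` is a weighted sum of the errors plus a deterministic term tending to `0`. -/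
lemma tendstoInDistribution_joint {Ω Ω' : Type*} [MeasurableSpace Ω] [MeasurableSpace Ω']
    {P : Measure Ω} [IsProbabilityMeasure P] {P' : Measure Ω'} [IsProbabilityMeasure P']
    {K β : ℝ → ℝ} {x c σ : ℝ} (hx : x ∈ Set.Ioo (0 : ℝ) 1) (hc : 0 < c) (hσ : 0 < σ)
    (hK : IsKernel K) (hβ : ContDiffOn ℝ 3 β (Set.Icc 0 1)) {ε : ℕ → Ω → ℝ}
    (hε : IsErrorSequence P ε σ) {ξ₁ ξ₂ : Ω' → ℝ}
    (hξ : HasLaw (fun ω' => !₂[ξ₁ ω', ξ₂ ω']) (multivariateGaussian 0 (limitVar (σ ^ 2) K)) P') :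
    TendstoInDistribution (fun n ω => (stat K c β x n (sample β ε n ω) - bias K c β x n,
      bootBias K c x n (sample β ε n ω) - bias K c β x n)) atTop
      (fun ω' => (ξ₁ ω', ξ₂ ω')) (fun _ => P) P' := by
  have hV := (hK.posDef_limitVar (pow_pos hσ 2)).posSemidef
  have hms : ∀ n, Measurable fun ω => stat K c β x n (sample β ε n ω) - bias K c β x n := fun n =>
    (((((measurable_nw K c n x).comp (hε.measurable_sample β n)).sub_const _).const_mul _).sub_const
      _ :)
  have hmb : ∀ n, Measurable fun ω => bootBias K c x n (sample β ε n ω) - bias K c β x n :=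
    fun n => ((measurable_bootBias K c x n).comp (hε.measurable_sample β n)).sub_const _
  have hmZ : ∀ n, Measurable fun ω => !₂[stat K c β x n (sample β ε n ω) - bias K c β x n,
      bootBias K c x n (sample β ε n ω) - bias K c β x n] := by
    intro n
    refine (WithLp.measurable_toLp 2 _).comp (measurable_pi_lambda _ fun i => ?_)
    fin_cases i
    · exact hms n
    · exact hmb n
  have key : TendstoInDistribution (fun n ω =>
      !₂[stat K c β x n (sample β ε n ω) - bias K c β x n,
        bootBias K c x n (sample β ε n ω) - bias K c β x n]) atTop
      (fun ω' => !₂[ξ₁ ω', ξ₂ ω']) (fun _ => P) P' := by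
    refine ⟨fun n => (hmZ n).aemeasurable, hξ.aemeasurable, ?_⟩
    refine ProbabilityMeasure.tendsto_iff_tendsto_charFun.2 fun w => ?_
    set δ : ℕ → ℝ := fun n => √(n * bandwidth c n) *
      (nw K c n (fun t => nw K c n (fun s => β (design n s)) (design n t)) x -
        nw K c n (fun t => β (design n t)) x -
        (nw K c n (fun t => β (design n t)) x - β x))
    have hδ : Tendsto δ atTop (𝓝 0) := hK.tendsto_smoothed_bias_sub hβ hx hc
    obtain ⟨⟨η, hη, hηb⟩, hsq⟩ := hK.scaled_errorWeight_asymptotics hx hc (w 0) (w 1)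
    have hclt := hε.tendsto_charFun_weightedSum hσ hη hηb hsq
    have hinner : ∀ n ω, inner ℝ (!₂[stat K c β x n (sample β ε n ω) - bias K c β x n,
        bootBias K c x n (sample β ε n ω) - bias K c β x n]) w =
        ∑ s : Fin n, (√(n * bandwidth c n) * (n * bandwidth c n)⁻¹ *
          errorWeight K c x (w 0) (w 1) n s) * ε s ω + w 1 * δ n := by
      intro n ω
      rw [← sqrt_mul_nw_combination, stat_sub_bias, bootBias_sub_bias]
      simp [PiLp.inner_apply, Fin.sum_univ_two, δ]
      ring
    have hchar : ∀ n, charFun (P.map fun ω =>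
        !₂[stat K c β x n (sample β ε n ω) - bias K c β x n,
          bootBias K c x n (sample β ε n ω) - bias K c β x n]) w =
        charFun (P.map fun ω => ∑ s : Fin n, (√(n * bandwidth c n) * (n * bandwidth c n)⁻¹ *
          errorWeight K c x (w 0) (w 1) n s) * ε s ω) 1 *
          Complex.exp ((w 1 * δ n : ℝ) * Complex.I) := by
      intro n
      have hm : Measurable fun ω => ∑ s : Fin n, (√(n * bandwidth c n) * (n * bandwidth c n)⁻¹ *
          errorWeight K c x (w 0) (w 1) n s) * ε s ω :=
        Finset.measurable_fun_sum _ fun s _ => (hε.measurable s).const_mul _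
      rw [charFun_apply, charFun_apply_real, integral_map (hmZ n).aemeasurable (by fun_prop),
        integral_map hm.aemeasurable (by fun_prop), ← integral_mul_const]
      refine integral_congr_ae (Eventually.of_forall fun ω => ?_)
      simp only [hinner]
      rw [← Complex.exp_add]
      congr 1
      push_cast
      ring
    have hphase : Tendsto (fun n => Complex.exp ((w 1 * δ n : ℝ) * Complex.I)) atTop (𝓝 1) := by
      have hcont : Continuous fun r : ℝ => Complex.exp ((w 1 * r : ℝ) * Complex.I) := by fun_prop
      have h := (hcont.tendsto 0).comp hδ
      simp only [mul_zero, Complex.ofReal_zero, zero_mul, Complex.exp_zero] at h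
      exact h
    have hlim := hclt.mul hphase
    rw [mul_one] at hlim
    have htarget : charFun (P'.map fun ω' => !₂[ξ₁ ω', ξ₂ ω']) w =
        Complex.exp (-(σ ^ 2 * (∫ u, limitWeight K (w 0) (w 1) u ^ 2) / 2 : ℝ)) := by
      rw [hξ.map_eq, charFun_multivariateGaussian hV, hK.dotProduct_limitVar]
      simp
    rw [ProbabilityMeasure.coe_mk, htarget]
    refine hlim.congr fun n => ?_
    rw [ProbabilityMeasure.coe_mk, hchar]
  exact key.continuous_comp (g := fun v : EuclideanSpace ℝ (Fin 2) => (v 0, v 1)) (by fun_prop)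

/-! ### The conditional law of the bootstrap statistic -/

/-- Continuous mapping for convergence in probability to a constant, where the argument is scaled by
a convergent deterministic sequence and continuity is needed only at the limit. -/
lemma tendstoInMeasure_comp_mul {Ω : Type*} [MeasurableSpace Ω] {P : Measure Ω}
    {Z : ℕ → Ω → ℝ} {a b : ℝ} {r : ℕ → ℝ} {g : ℝ → ℝ}
    (hZ : TendstoInMeasure P Z atTop fun _ => a) (hr : Tendsto r atTop (𝓝 b))
    (hg : ContinuousAt g (a * b)) :
    TendstoInMeasure P (fun n ω => g (Z n ω * r n)) atTop fun _ => g (a * b) := by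
  rw [tendstoInMeasure_iff_dist] at hZ ⊢
  intro η hη
  have hcont : ContinuousAt (fun v : ℝ × ℝ => g (v.1 * v.2)) (a, b) :=
    ContinuousAt.comp (f := fun v : ℝ × ℝ => v.1 * v.2) hg continuous_mul.continuousAt
  obtain ⟨d, hd, hball⟩ := Metric.continuousAt_iff.1 hcont η hη
  have hr' := Metric.tendsto_nhds.1 hr d hd
  refine tendsto_of_tendsto_of_tendsto_of_le_of_le' tendsto_const_nhds (hZ d hd)
    (Eventually.of_forall fun _ => zero_le) ?_
  filter_upwards [hr'] with n hn
  refine measure_mono fun ω hω => ?_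
  by_contra hlt
  have h := hball (x := (Z n ω, r n)) (by
    rw [Prod.dist_eq]
    exact max_lt (not_le.1 hlt) hn)
  exact absurd h (not_lt.2 hω)

lemma limitWeight_one_zero (K : ℝ → ℝ) : limitWeight K 1 0 = K := by
  funext u
  simp [limitWeight]

/-- Given the data, `Tₙ* - B̂ₙ` is a linear form in the bootstrap errors, hence exactly normal; its
variance is a consistent multiple of the variance estimator. -/
lemma tendstoBootstrapDistribution_bootStat {Ω Ω' : Type*} [MeasurableSpace Ω]
    [MeasurableSpace Ω'] {P : Measure Ω} [IsProbabilityMeasure P] {P' : Measure Ω'}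
    {K β : ℝ → ℝ} {x c σ : ℝ} (hx : x ∈ Set.Ioo (0 : ℝ) 1) (hc : 0 < c) (hσ : 0 < σ)
    (hK : IsKernel K) {ε : ℕ → Ω → ℝ} (hε : IsErrorSequence P ε σ)
    {varEst : ∀ n : ℕ, (Fin n → ℝ) → ℝ≥0}
    (hvar : TendstoInMeasure P (fun n ω => (varEst n (sample β ε n ω) : ℝ)) atTop
      (fun _ => σ ^ 2))
    {εstar : ∀ n : ℕ, Ω → Fin n → ℝ}
    (hεstar : IsGaussianBootstrapErrors P (sample β ε) varEst εstar) {ξ₁ : Ω' → ℝ}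
    (hξ₁ : HasLaw ξ₁ (gaussianReal 0 (vSq (σ ^ 2) K).toNNReal) P') :
    TendstoBootstrapDistribution P
      (fun n => MeasurableSpace.comap (sample β ε n) inferInstance)
      (fun n ω => bootStat K c x n (sample β ε n ω) (εstar n ω) -
        bootBias K c x n (sample β ε n ω)) P' ξ₁ := by
  set b : ∀ n : ℕ, Fin n → ℝ := fun n s =>
    √(n * bandwidth c n) * (n * bandwidth c n)⁻¹ * errorWeight K c x 1 0 n s
  have hlin : ∀ (n : ℕ) (e : Fin n → ℝ), √(n * bandwidth c n) * nw K c n e x =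
      ∑ s, b n s * e s := fun n e => by
    have h := sqrt_mul_nw_combination K c x 1 0 n e
    rwa [one_mul, zero_mul, add_zero] at h
  have hml : ∀ n : ℕ, Measurable fun e : Fin n → ℝ => ∑ s, b n s * e s := fun n =>
    measurable_sum_mul (b n)
  have hsq : Tendsto (fun n => ∑ s, b n s ^ 2) atTop (𝓝 (∫ u, K u ^ 2)) := by
    have h := (hK.scaled_errorWeight_asymptotics hx hc 1 0).2
    rwa [limitWeight_one_zero] at h
  have hY : ∀ n ω, bootStat K c x n (sample β ε n ω) (εstar n ω) -
      bootBias K c x n (sample β ε n ω) = ∑ s, b n s * εstar n ω s := fun n ω => by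
    rw [bootStat_sub_bootBias, hlin]
  refine ⟨fun n => (hε.measurable_sample β n).comap_le, fun n => ?_, fun u _ => ?_⟩
  · simp_rw [hY]
    exact ((hml n).comp (hεstar.measurable n)).aemeasurable
  · have hcond : ∀ n, (fun ω => normalCdf ((varEst n (sample β ε n ω) : ℝ) * ∑ s, b n s ^ 2) u)
        =ᵐ[P] P⟦{ω | bootStat K c x n (sample β ε n ω) (εstar n ω) -
          bootBias K c x n (sample β ε n ω) ≤ u} |
            MeasurableSpace.comap (sample β ε n) inferInstance⟧ := by
      intro n
      have hset : {ω | bootStat K c x n (sample β ε n ω) (εstar n ω) -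
          bootBias K c x n (sample β ε n ω) ≤ u} =
          εstar n ⁻¹' ((fun e : Fin n → ℝ => ∑ s, b n s * e s) ⁻¹' Set.Iic u) := by
        ext ω
        simp [hY]
      rw [hset]
      refine EventuallyEq.trans ?_ (condDistrib_ae_eq_condExp (hε.measurable_sample β n)
        (hεstar.measurable n) (hml n measurableSet_Iic))
      filter_upwards [ae_of_ae_map (hε.measurable_sample β n).aemeasurable (hεstar.condLaw n)]
        with ω hω
      rw [hω, ← map_measureReal_apply (hml n) measurableSet_Iic, map_pi_gaussianReal_linear,
        normalCdf]
    have hR : 0 < σ ^ 2 * ∫ u, K u ^ 2 := mul_pos (pow_pos hσ 2) hK.integral_sq_pos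
    have hlim : ∀ ω : Ω, P'.real {ω' | ξ₁ ω' ≤ u} = normalCdf (σ ^ 2 * ∫ u, K u ^ 2) u :=
      fun _ => measureReal_le_eq_normalCdf hξ₁ u
    exact (tendstoInMeasure_comp_mul hvar hsq (continuousAt_normalCdf_variance hR u)).congr hcond
      (Eventually.of_forall fun ω => (hlim ω).symm)

end NPBoot

theorem lemma6 {Ω Ω' : Type*} [MeasurableSpace Ω] [MeasurableSpace Ω']
    (P : Measure Ω) [IsProbabilityMeasure P] (P' : Measure Ω') [IsProbabilityMeasure P']
    (K β : ℝ → ℝ) (x c σ : ℝ)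
    (hx : x ∈ Set.Ioo (0 : ℝ) 1) (hc : 0 < c) (hσ : 0 < σ)
    (hK : NPBoot.IsKernel K)
    (hβ : ContDiffOn ℝ 3 β (Set.Icc 0 1))
    (ε : ℕ → Ω → ℝ) (hε : NPBoot.IsErrorSequence P ε σ)
    (varEst : ∀ n : ℕ, (Fin n → ℝ) → ℝ≥0) (hvar_meas : ∀ n, Measurable (varEst n))
    (hvar : TendstoInMeasure P (fun n ω => (varEst n (NPBoot.sample β ε n ω) : ℝ)) atTop
      (fun _ => σ ^ 2))
    (εstar : ∀ n : ℕ, Ω → Fin n → ℝ)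
    (hεstar : NPBoot.IsGaussianBootstrapErrors P (NPBoot.sample β ε) varEst εstar)
    (ξ₁ ξ₂ : Ω' → ℝ)
    (hξ : HasLaw (fun ω' => !₂[ξ₁ ω', ξ₂ ω'])
      (multivariateGaussian 0 (NPBoot.limitVar (σ ^ 2) K)) P') :
    NPBoot.BiasedLimit P
        (fun n ω => NPBoot.stat K c β x n (NPBoot.sample β ε n ω))
        (fun n _ => NPBoot.bias K c β x n) P' ξ₁ ∧
      NPBoot.BootstrapBiasedLimit P
        (fun n => MeasurableSpace.comap (NPBoot.sample β ε n) inferInstance)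
        (fun n ω => NPBoot.stat K c β x n (NPBoot.sample β ε n ω))
        (fun n _ => NPBoot.bias K c β x n)
        (fun n ω => NPBoot.bootStat K c x n (NPBoot.sample β ε n ω) (εstar n ω))
        (fun n ω => NPBoot.bootBias K c x n (NPBoot.sample β ε n ω)) P' ξ₁ ξ₂ ∧
      (NPBoot.limitVar (σ ^ 2) K).PosDef ∧
      (∀ (s : ℕ → ℝ) (κ : ℕ → ℝ → ℝ), Tendsto s atTop (𝓝 (σ ^ 2)) →
        (∀ m, NPBoot.IsKernel (κ m)) →
        Tendsto (fun m => ∫ u, (κ m u - K u) ^ 2) atTop (𝓝 0) →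
        Tendsto (fun m => NPBoot.limitVar (s m) (κ m)) atTop
          (𝓝 (NPBoot.limitVar (σ ^ 2) K))) := by
  have hσ2 : 0 < σ ^ 2 := pow_pos hσ 2
  have hpd := hK.posDef_limitVar hσ2
  have hlaw : ∀ p q : ℝ, HasLaw (fun ω' => p * ξ₁ ω' + q * ξ₂ ω')
      (gaussianReal 0 (σ ^ 2 * ∫ u, NPBoot.limitWeight K p q u ^ 2).toNNReal) P' := by
    intro p q
    have h := NPBoot.hasLaw_linear_of_hasLaw_multivariateGaussian hpd.posSemidef hξ ![p, q]
    rw [hK.dotProduct_limitVar] at h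
    simpa using h
  have hpos : ∀ p q : ℝ, p ≠ 0 ∨ q ≠ 0 → 0 < σ ^ 2 * ∫ u, NPBoot.limitWeight K p q u ^ 2 :=
    fun p q hpq => mul_pos hσ2 (hK.integral_limitWeight_sq_pos hpq)
  have hξ₁ : HasLaw ξ₁ (gaussianReal 0 (NPBoot.vSq (σ ^ 2) K).toNNReal) P' := by
    have h := hlaw 1 0
    rw [NPBoot.limitWeight_one_zero] at h
    simpa [NPBoot.vSq] using h
  have hvSq : 0 < NPBoot.vSq (σ ^ 2) K := mul_pos hσ2 hK.integral_sq_pos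
  have hξ₂ := hlaw 0 1
  have hdiff := hlaw 1 (-1)
  simp only [zero_mul, one_mul, zero_add, neg_mul, ← sub_eq_add_neg] at hξ₂ hdiff
  have hjoint := NPBoot.tendstoInDistribution_joint hx hc hσ hK hβ hε hξ
  refine ⟨⟨hjoint.continuous_comp continuous_fst, NPBoot.integrable_of_hasLaw_gaussianReal hξ₁,
      NPBoot.integral_eq_zero_of_hasLaw_gaussianReal hξ₁, ?_, ?_⟩,
    ⟨fun n => (NPBoot.measurable_bootBias K c x n).comp (comap_measurable _),
      NPBoot.tendstoBootstrapDistribution_bootStat hx hc hσ hK hε hvar hεstar hξ₁, hjoint,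
      NPBoot.integrable_of_hasLaw_gaussianReal hξ₂,
      NPBoot.integral_eq_zero_of_hasLaw_gaussianReal hξ₂, ?_⟩, hpd,
    fun s κ hs hκ hlim => hK.tendsto_limitVar hs hκ hlim⟩
  · simp_rw [NPBoot.measureReal_le_eq_normalCdf hξ₁]
    exact NPBoot.continuous_normalCdf hvSq
  · simp_rw [NPBoot.measureReal_le_eq_normalCdf hξ₁]
    exact (NPBoot.strictMono_normalCdf hvSq).strictMonoOn _
  · simp_rw [NPBoot.measureReal_le_eq_normalCdf hdiff]
    exact NPBoot.continuous_normalCdf (hpos 1 (-1) (Or.inl one_ne_zero))
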